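/- Let $K$ be a field of characteristic zero with $m$ mutually commuting endomorphisms (translations) $\alpha_1,\dots,\alpha_m$, which are assigned positive integer weights $w_1,\dots,w_m$. Let $T$ be the free commutative semigroup of formal power products $\tau=\alpha_1^{k_1}\cdots\alpha_m^{k_m}$ ($k_i\in\mathbb{N}$), and put $\operatorname{ord}_w\tau=\sum_i w_ik_i$. Let $L$ be a difference field extension of $K$ (a field extension with commuting endomorphisms extending the $\alpha_i$), generated as a difference field by finitely many elements, $L=K\langle\eta_1,\dots,\eta_n\rangle$; that is, $L$ is generated as a field over $K$ by all $\tau\eta_i$ ($\tau\in T$, $1\le i\le n$). For $r\in\mathbb{N}$ let $L_r=K(\{\tau\eta_i : \tau\in T,\ \operatorname{ord}_w\tau\le r,\ 1\le i\le n\})$. A quasi-polynomial is a function $f:\mathbb{Z}\to\mathbb{Q}$ of the form $f(t)=\sum_{i=0}^{d}c_i(t)t^i$, where each coefficient $c_i:\mathbb{Z}\to\mathbb{Q}$ is periodic with some positive integer period; if $c_d\neq 0$ as a function, $d$ is the degree and $c_d$ the leading coefficient (the zero quasi-polynomial has degree $-\infty$ and leading coefficient $0$). Let $\lambda_w$ be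 the Ehrhart quasi-polynomial of the conic polytope $\{x\in\mathbb{R}^m : x_j\ge 0\ (1\le j\le m),\ \sum_i w_ix_i\le 1\}$, i.e. the quasi-polynomial whose value at every integer $r\ge1$ is the number of integer points of its $r$-th dilate $\{x\in\mathbb{R}^m : x_j\ge 0,\ \sum_i w_ix_i\le r\}$. Then there exists a quasi-polynomial $\Phi=\Phi^{(w)}_{\eta|K}$ such that: (i) $\Phi(r)=\operatorname{trdeg}_K L_r$ (in particular this is finite) for all sufficiently large $r\in\mathbb{N}$. (ii) $\deg\Phi\le m$. (iii) $\Phi$ is an alternating sum of Ehrhart quasi-polynomials associated with conic polytopes: there are finitely many signs $\varepsilon_i\in\{1,-1\}$ and shifts $c_i\in\mathbb{N}$ with $\Phi(t)=\sum_i\varepsilon_i\,\lambda_w(t-c_i)$ for all $t\in\mathbb{Z}$. (iv) The leading coefficient of $\Phi$ is constant, and the degree and the leading coefficient do not depend on the choice of generators: if $\zeta_1,\dots,\zeta_k$ is another finite system with $L=K\langle\zeta_1,\dots,\zeta_k\rangle$, then every quasi-polynomial satisfying (i) for $\zeta$ has the same degree and the same leading coefficient as $\Phi$. Furthermore, the coefficient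 of $t^m$ in $\Phi$ is the constant $\dfrac{a}{m!\,w_1\cdots w_m}$, where $a$ is the difference transcendence degree of $L/K$, i.e. the (finite and common) number of elements of the difference transcendence bases of $L$ over $K$. Here $B\subseteq L$ is a difference transcendence basis if the family $(\tau b)_{\tau\in T,\,b\in B}$ is algebraically independent over $K$ and, for every $x\in L$, the family $(\tau x)_{\tau\in T}$ is algebraically dependent over $K\langle B\rangle$. -/

import Mathlib

open scoped Pointwise Nat
open Filter

namespace WeightedDifference

/-! ### Quasi-polynomials -/

/-- Rational periodic numbers: functions `U : ℤ → ℚ` having some period `q ≥ 1`, with pointwise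
operations. The image of `c : ℚ` under `algebraMap` is the constant function `c`. -/
def periodicNumber : Subalgebra ℚ (ℤ → ℚ) where
  carrier := {U | ∃ q : ℕ, 0 < q ∧ Function.Periodic U (q : ℤ)}
  mul_mem' := by
    rintro U V ⟨p, hp, hU⟩ ⟨q, hq, hV⟩
    refine ⟨p * q, Nat.mul_pos hp hq, fun n => ?_⟩
    have h1 : U (n + ((p * q : ℕ) : ℤ)) = U n := by
      have h := hU.nat_mul q n
      push_cast
      rw [mul_comm]
      exact h
    have h2 : V (n + ((p * q : ℕ) : ℤ)) = V n := by
      have h := hV.nat_mul p n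
      push_cast
      exact h
    simp only [Pi.mul_apply, h1, h2]
  add_mem' := by
    rintro U V ⟨p, hp, hU⟩ ⟨q, hq, hV⟩
    refine ⟨p * q, Nat.mul_pos hp hq, fun n => ?_⟩
    have h1 : U (n + ((p * q : ℕ) : ℤ)) = U n := by
      have h := hU.nat_mul q n
      push_cast
      rw [mul_comm]
      exact h
    have h2 : V (n + ((p * q : ℕ) : ℤ)) = V n := by
      have h := hV.nat_mul p n
      push_cast
      exact h
    simp only [Pi.add_apply, h1, h2]
  algebraMap_mem' := fun c => ⟨1, one_pos, fun _ => rfl⟩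

/-- A (univariate) quasi-polynomial `∑ cᵢ(t) tⁱ` whose coefficients `cᵢ` are rational periodic
numbers. Its degree, leading coefficient and the coefficient of `tⁱ` are those of the
polynomial. (The coefficients are determined by the values at all large natural numbers.) -/
abbrev QuasiPolynomial : Type := Polynomial periodicNumber

/-- The value `∑ cᵢ(n) nⁱ` of a quasi-polynomial at an integer `n`. -/
noncomputable def evalAt (f : QuasiPolynomial) (n : ℤ) : ℚ :=
  Polynomial.eval₂ ((Pi.evalRingHom (fun _ : ℤ => ℚ) n).comp
    (periodicNumber.val : periodicNumber →+* (ℤ → ℚ))) (n : ℚ) f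

/-! ### Ehrhart quasi-polynomials of conic polytopes -/

/-- `L(P, r)`: the number of points with integer coordinates in the dilate `r P`. -/
noncomputable def latticeCount {d : ℕ} (P : Set (Fin d → ℝ)) (r : ℕ) : ℕ :=
  Set.ncard {z : Fin d → ℤ | (fun i => (z i : ℝ)) ∈ (r : ℝ) • P}

/-- `f` is the Ehrhart quasi-polynomial of the polytope `P`: `f(r) = L(P, r)` for all `r ≥ 1`. -/
def IsEhrhart {d : ℕ} (P : Set (Fin d → ℝ)) (f : QuasiPolynomial) : Prop :=
  ∀ r : ℕ, 1 ≤ r → evalAt f (r : ℤ) = (latticeCount P r : ℚ)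

/-- The conic polytope of the weights `w`; its `r`-th dilate is `{x ≥ 0 | ∑ wᵢ xᵢ ≤ r}`. -/
def conicPolytope {m : ℕ} (w : Fin m → ℕ) : Set (Fin m → ℝ) :=
  {x | (∀ j, 0 ≤ x j) ∧ ∑ i, (w i : ℝ) * x i ≤ 1}

/-- `Φ(t) = ∑ᵢ ± λ(t - cᵢ)`, a finite sum with signs, where `λ` is the Ehrhart quasi-polynomial
of the conic polytope of the weights `w` and the shifts `cᵢ` are natural numbers. -/
def IsAlternatingEhrhartSum {m : ℕ} (w : Fin m → ℕ) (Φ : QuasiPolynomial) : Prop :=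
  ∃ lam : QuasiPolynomial, IsEhrhart (conicPolytope w) lam ∧
    ∃ (N : ℕ) (ε : Fin N → ℤˣ) (c : Fin N → ℕ),
      ∀ t : ℤ, evalAt Φ t = ∑ i, ((ε i : ℤ) : ℚ) * evalAt lam (t - (c i : ℤ))

/-! ### Difference fields -/

/-- A difference structure on a field: `m` mutually commuting endomorphisms (translations).
They are injective, being ring homomorphisms between fields. -/
structure Translations (m : ℕ) (F : Type*) [Field F] where
  /-- the translations -/
  trans : Fin m → F →+* F
  comm : ∀ i j, (trans i).comp (trans j) = (trans j).comp (trans i)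

/-- The action of the power product `α₁^k₁ ⋯ αₘ^kₘ`. -/
def Translations.transform {m : ℕ} {F : Type*} [Field F] (σ : Translations m F)
    (k : Fin m → ℕ) : F →+* F :=
  (List.ofFn fun i => σ.trans i ^ k i).prod

/-- `L` with the translations `σL` is a difference field extension of `K` with `σK`. -/
def IsDifferenceExtension {m : ℕ} {K L : Type*} [Field K] [Field L] [Algebra K L]
    (σK : Translations m K) (σL : Translations m L) : Prop :=
  ∀ i x, σL.trans i (algebraMap K L x) = algebraMap K L (σK.trans i x)

/-- The weighted order `w₁ k₁ + ⋯ + wₘ kₘ` of the power product with exponents `k`. -/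
def weightedOrder {m : ℕ} (w k : Fin m → ℕ) : ℕ := ∑ i, w i * k i

section

variable (K : Type*) {L : Type*} [Field K] [Field L] [Algebra K L] {m : ℕ} (σ : Translations m L)

/-- The difference field `K⟨S⟩`, generated over `K` by all transforms of elements of `S`. -/
def diffAdjoin (S : Set L) : IntermediateField K L :=
  IntermediateField.adjoin K {x | ∃ k : Fin m → ℕ, ∃ s ∈ S, x = σ.transform k s}

/-- The field `L_r`, generated over `K` by the transforms of the `ηᵢ` of weighted order `≤ r`. -/
def truncation (w : Fin m → ℕ) {n : ℕ} (η : Fin n → L) (r : ℕ) : IntermediateField K L :=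
  IntermediateField.adjoin K
    {x | ∃ k : Fin m → ℕ, weightedOrder w k ≤ r ∧ ∃ i, x = σ.transform k (η i)}

/-- `L = K⟨η₁, …, ηₙ⟩`. -/
def Generates {n : ℕ} (η : Fin n → L) : Prop := diffAdjoin K σ (Set.range η) = ⊤

/-- `Φ(r) = trdeg_K L_r` for all sufficiently large `r` (the transcendence degree, a cardinal,
being a natural number). -/
def IsDimensionQuasiPolynomial (w : Fin m → ℕ) {n : ℕ} (η : Fin n → L)
    (Φ : QuasiPolynomial) : Prop :=
  ∀ᶠ r : ℕ in atTop, ∃ d : ℕ,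
    Algebra.trdeg K (truncation K σ w η r) = (d : Cardinal) ∧ evalAt Φ (r : ℤ) = (d : ℚ)

/-- `B` is a difference transcendence basis of `L` over `K`: the family of all transforms of
elements of `B` is algebraically independent over `K`, and for every `a` in `L` the family of
all transforms of `a` is algebraically dependent over `K⟨B⟩`. -/
structure IsDiffTranscendenceBasis (B : Set L) : Prop where
  indep : AlgebraicIndependent K (fun p : (Fin m → ℕ) × B => σ.transform p.1 (p.2 : L))
  algebraic : ∀ a : L, ¬ AlgebraicIndependent (diffAdjoin K σ B)
    (fun k : Fin m → ℕ => σ.transform k a)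

/-- The difference transcendence degree of `L` over `K` is the natural number `a`: difference
transcendence bases exist, and each of them is finite with exactly `a` elements. -/
def HasDiffTrdeg (a : ℕ) : Prop :=
  (∃ B : Set L, IsDiffTranscendenceBasis K σ B) ∧
    ∀ B : Set L, IsDiffTranscendenceBasis K σ B → B.Finite ∧ B.ncard = a

end

end WeightedDifference

/-!
Order the transforms `τ ηⱼ` by weighted order, refined to a well-order compatible with
translations. The transforms which are not algebraic over the preceding ones form a transcendence
basis, compatibly with the truncations `L_r`, and for each `j` the exponents of the remaining
transforms of `ηⱼ` form an upper set `Eⱼ` of `ℕᵐ`. So `trdeg_K L_r` is the number of pairs `(k, j)`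
with `k ∉ Eⱼ` of weighted order at most `r`. By Dickson's lemma the complement of an upper set
decomposes into finitely many translated orthants, whose lattice points are counted by iterated
differences of `λ_w`; only the `j` with `Eⱼ = ∅` contribute to `t ^ m`. Comparing the truncations
of two finite families, one of which generates `L`, shows that the number of these `j` is the
difference transcendence degree and that the degree and the leading coefficient do not depend on
the generators.
-/

namespace WeightedDifference

open scoped Topology
open Polynomial hiding eval

/-! ### Values of quasi-polynomials -/

theorem evalAt_add (Φ Ψ : QuasiPolynomial) (t : ℤ) :
    evalAt (Φ + Ψ) t = evalAt Φ t + evalAt Ψ t :=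
  eval₂_add _ _

theorem evalAt_sub (Φ Ψ : QuasiPolynomial) (t : ℤ) :
    evalAt (Φ - Ψ) t = evalAt Φ t - evalAt Ψ t :=
  eval₂_sub _

theorem evalAt_eq_sum_range {Φ : QuasiPolynomial} {n : ℕ} (hn : Φ.natDegree < n) (t : ℤ) :
    evalAt Φ t = ∑ i ∈ Finset.range n, (Φ.coeff i : ℤ → ℚ) t * (t : ℚ) ^ i :=
  eval₂_eq_sum_range' _ hn _

theorem exists_abs_le_of_periodicNumber (u : periodicNumber) :
    ∃ C : ℚ, ∀ t, |(u : ℤ → ℚ) t| ≤ C := by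
  obtain ⟨u, q, hq, hu⟩ := u
  have hfin : (Set.range u).Finite := by
    rw [← hu.image_Ioc (by exact_mod_cast hq) 0]
    exact (Set.finite_Ioc _ _).image u
  obtain ⟨C, hC⟩ := (hfin.image abs).bddAbove
  exact ⟨C, fun t => hC ⟨u t, ⟨t, rfl⟩, rfl⟩⟩

theorem eq_zero_of_tendsto_of_periodicNumber {u : periodicNumber}
    (h : Tendsto (u : ℤ → ℚ) atTop (𝓝 0)) : u = 0 := by
  obtain ⟨u, q, hq, hu⟩ := u
  have hq' : (0 : ℤ) < q := by exact_mod_cast hq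
  ext t
  have htop : Tendsto (fun n : ℕ => t + n * (q : ℤ)) atTop atTop :=
    tendsto_atTop_add_const_left _ t (tendsto_natCast_atTop_atTop.atTop_mul_const' hq')
  refine tendsto_nhds_unique (tendsto_const_nhds.congr fun n => ?_) (h.comp htop)
  exact (hu.nat_mul n t).symm

theorem tendsto_evalAt_div_pow_sub_coeff {Φ : QuasiPolynomial} {d : ℕ} (hd : Φ.natDegree ≤ d) :
    Tendsto (fun t : ℤ => evalAt Φ t / (t : ℚ) ^ d - (Φ.coeff d : ℤ → ℚ) t) atTop (𝓝 0) := by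
  have hlower : Tendsto (fun t : ℤ => ∑ i ∈ Finset.range d,
      (Φ.coeff i : ℤ → ℚ) t * ((t : ℚ) ^ i / (t : ℚ) ^ d)) atTop (𝓝 0) := by
    rw [← Finset.sum_const_zero (s := Finset.range d)]
    refine tendsto_finsetSum _ fun i hi => ?_
    obtain ⟨C, hC⟩ := exists_abs_le_of_periodicNumber (Φ.coeff i)
    exact bdd_le_mul_tendsto_zero' C (.of_forall hC)
      ((tendsto_pow_div_pow_atTop_zero (Finset.mem_range.1 hi)).comp tendsto_intCast_atTop_atTop)
  refine hlower.congr' ?_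
  filter_upwards [eventually_gt_atTop 0] with t ht
  have ht' : (t : ℚ) ^ d ≠ 0 := pow_ne_zero _ (by exact_mod_cast ht.ne')
  rw [evalAt_eq_sum_range (Nat.lt_succ_of_le hd), Finset.sum_range_succ, add_div,
    mul_div_cancel_right₀ _ ht', add_sub_cancel_right, Finset.sum_div]
  simp only [mul_div_assoc]

theorem eq_zero_of_evalAt_eventuallyEq {Φ : QuasiPolynomial} (h : evalAt Φ =ᶠ[atTop] 0) :
    Φ = 0 := by
  rw [← leadingCoeff_eq_zero]
  apply eq_zero_of_tendsto_of_periodicNumber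
  have hlim := (tendsto_evalAt_div_pow_sub_coeff (le_refl Φ.natDegree)).neg
  rw [neg_zero] at hlim
  refine hlim.congr' ?_
  filter_upwards [h] with t ht
  simp only [ht, Pi.zero_apply, zero_div, zero_sub, neg_neg, coeff_natDegree]

theorem eq_of_evalAt_eventuallyEq {Φ Ψ : QuasiPolynomial} (h : evalAt Φ =ᶠ[atTop] evalAt Ψ) :
    Φ = Ψ :=
  sub_eq_zero.1 <| eq_zero_of_evalAt_eventuallyEq <| h.mono fun t ht => by
    rw [evalAt_sub, ht, sub_self, Pi.zero_apply]

/-! ### The translation operator -/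

/-- The translation operator `f ↦ f (· - 1)`. -/
def shift : Module.End ℚ (ℤ → ℚ) :=
  LinearMap.funLeft ℚ ℚ (· - 1)

theorem shift_pow_apply (n : ℕ) (f : ℤ → ℚ) (t : ℤ) : (shift ^ n) f t = f (t - n) := by
  induction n generalizing t with
  | zero => simp
  | succ n ih =>
    rw [pow_succ', Module.End.mul_apply]
    exact (ih (t - 1)).trans (congrArg f (by push_cast; ring))

theorem shift_pow_congr {f g : ℤ → ℚ} (h : f =ᶠ[atTop] g) (n : ℕ) :
    (shift ^ n) f =ᶠ[atTop] (shift ^ n) g := by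
  filter_upwards [(tendsto_atTop_add_const_right atTop (-(n : ℤ)) tendsto_id).eventually h]
    with t ht
  simpa only [shift_pow_apply, sub_eq_add_neg, id] using ht

theorem aeval_shift_apply (P : ℚ[X]) (f : ℤ → ℚ) (t : ℤ) :
    aeval shift P f t = ∑ i ∈ Finset.range (P.natDegree + 1), P.coeff i * f (t - i) := by
  simp only [aeval_eq_sum_range, LinearMap.sum_apply, LinearMap.smul_apply, Finset.sum_apply,
    Pi.smul_apply, shift_pow_apply, smul_eq_mul]

theorem aeval_shift_congr {P : ℚ[X]} {f g : ℤ → ℚ} {n : ℕ} (hP : P.natDegree ≤ n)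
    (h : ∀ t, -(n : ℤ) ≤ t → f t = g t) {t : ℤ} (ht : 0 ≤ t) :
    aeval shift P f t = aeval shift P g t := by
  rw [aeval_shift_apply, aeval_shift_apply]
  refine Finset.sum_congr rfl fun i hi => ?_
  rw [h (t - i) (by have := Finset.mem_range.1 hi; lia)]

theorem aeval_shift_eq_zero_of_neg (P : ℚ[X]) {f : ℤ → ℚ} (h : ∀ t < 0, f t = 0) {t : ℤ}
    (ht : t < 0) : aeval shift P f t = 0 := by
  rw [aeval_shift_apply]
  exact Finset.sum_eq_zero fun i _ => by rw [h (t - i) (by lia), mul_zero]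

theorem eq_of_sub_shift_pow_eq {f g : ℤ → ℚ} {c : ℕ} (hc : 0 < c) (hf : ∀ t < 0, f t = 0)
    (hg : ∀ t < 0, g t = 0) (h : f - (shift ^ c) f = g - (shift ^ c) g) : f = g := by
  have hper : Function.Periodic (f - g) (c : ℤ) := fun t => by
    have := congrFun h (t + c)
    simp only [Pi.sub_apply, shift_pow_apply, add_sub_cancel_right] at this ⊢
    linarith
  funext t
  rw [← sub_eq_zero]
  have hneg : t - (t.toNat + 1 : ℕ) * (c : ℤ) < 0 := by
    have : (1 : ℤ) ≤ c := by exact_mod_cast hc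
    push_cast
    nlinarith [Int.self_le_toNat t]
  rw [← Pi.sub_apply, ← hper.sub_nat_mul_eq (t.toNat + 1), Pi.sub_apply, hf _ hneg, hg _ hneg,
    sub_zero]

/-! ### Leading terms of functions given by quasi-polynomials -/

/-- `f` is the function of a quasi-polynomial of degree at most `d` whose coefficient of `t ^ d` is
the constant `e` (possibly `0`). -/
def HasLeadingTerm (d : ℕ) (e : ℚ) (f : ℤ → ℚ) : Prop :=
  ∃ Φ : QuasiPolynomial, Φ.natDegree ≤ d ∧ Φ.coeff d = algebraMap ℚ periodicNumber e ∧
    evalAt Φ = f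

/-- The ring automorphism `u ↦ u (· - 1)` of the rational periodic numbers. -/
def periodicNumberShift : periodicNumber →+* periodicNumber where
  toFun u := ⟨fun t => (u : ℤ → ℚ) (t - 1), by
    obtain ⟨q, hq, hu⟩ := u.2
    exact ⟨q, hq, hu.sub_const 1⟩⟩
  map_one' := rfl
  map_mul' _ _ := rfl
  map_zero' := rfl
  map_add' _ _ := rfl

theorem evalAt_taylor_map_periodicNumberShift (Φ : QuasiPolynomial) (t : ℤ) :
    evalAt (taylor (-1) (Φ.map periodicNumberShift)) t = evalAt Φ (t - 1) := by
  rw [evalAt, taylor_apply, eval₂_comp, eval₂_map, eval₂_add, eval₂_X, eval₂_C, map_neg, map_one,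
    ← sub_eq_add_neg, evalAt]
  push_cast
  rfl

namespace HasLeadingTerm

variable {d : ℕ} {e e' : ℚ} {f f' : ℤ → ℚ}

theorem zero (d : ℕ) : HasLeadingTerm d 0 0 :=
  ⟨0, by simp, by simp, funext fun _ => eval₂_zero _ _⟩

theorem add (h : HasLeadingTerm d e f) (h' : HasLeadingTerm d e' f') :
    HasLeadingTerm d (e + e') (f + f') := by
  obtain ⟨Φ, hd, he, rfl⟩ := h
  obtain ⟨Φ', hd', he', rfl⟩ := h'
  exact ⟨Φ + Φ', natDegree_add_le_of_degree_le hd hd', by rw [coeff_add, he, he', map_add],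
    funext fun t => evalAt_add Φ Φ' t⟩

theorem smul (h : HasLeadingTerm d e f) (a : ℚ) : HasLeadingTerm d (a * e) (a • f) := by
  obtain ⟨Φ, hd, he, rfl⟩ := h
  refine ⟨C (algebraMap ℚ periodicNumber a) * Φ, (natDegree_C_mul_le _ _).trans hd,
    by rw [coeff_C_mul, he, map_mul], funext fun t => ?_⟩
  rw [evalAt, eval₂_mul, eval₂_C]
  rfl

theorem of_lt (h : HasLeadingTerm d e f) {d' : ℕ} (hd' : d < d') : HasLeadingTerm d' 0 f := by
  obtain ⟨Φ, hd, -, rfl⟩ := h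
  exact ⟨Φ, hd.trans hd'.le, by
    rw [coeff_eq_zero_of_natDegree_lt (hd.trans_lt hd'), map_zero], rfl⟩

theorem shift (h : HasLeadingTerm d e f) : HasLeadingTerm d e (shift f) := by
  obtain ⟨Φ, hd, he, rfl⟩ := h
  have hmap : (Φ.map periodicNumberShift).natDegree ≤ d := natDegree_map_le.trans hd
  refine ⟨taylor (-1) (Φ.map periodicNumberShift), by rwa [natDegree_taylor], ?_,
    funext fun t => evalAt_taylor_map_periodicNumberShift Φ t⟩
  have hcoeff : (Φ.map periodicNumberShift).coeff d = algebraMap ℚ periodicNumber e := by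
    rw [coeff_map, he]
    rfl
  rcases hmap.lt_or_eq with hlt | heq
  · rw [coeff_eq_zero_of_natDegree_lt hlt] at hcoeff
    rw [← hcoeff, coeff_eq_zero_of_natDegree_lt (by rwa [natDegree_taylor])]
  · rw [← hcoeff, ← heq, coeff_taylor_natDegree, coeff_natDegree]

theorem shift_pow (h : HasLeadingTerm d e f) (n : ℕ) :
    HasLeadingTerm d e ((WeightedDifference.shift ^ n) f) := by
  induction n with
  | zero => simpa using h
  | succ n ih =>
    rw [pow_succ', Module.End.mul_apply]
    exact ih.shift

theorem aeval_shift (h : HasLeadingTerm d e f) (P : ℚ[X]) :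
    HasLeadingTerm d (P.eval 1 * e) (aeval WeightedDifference.shift P f) := by
  induction P using Polynomial.induction_on' with
  | add P Q hP hQ => simpa [add_mul] using hP.add hQ
  | monomial n a => simpa [aeval_monomial, Algebra.algebraMap_eq_smul_one] using
      (h.shift_pow n).smul a

theorem tendsto (h : HasLeadingTerm d e f) :
    Tendsto (fun t : ℤ => f t / (t : ℚ) ^ d) atTop (𝓝 e) := by
  obtain ⟨Φ, hd, he, rfl⟩ := h
  have hlim := (tendsto_evalAt_div_pow_sub_coeff hd).add_const e
  rw [zero_add, he] at hlim
  exact hlim.congr fun t => sub_add_cancel _ _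

theorem le_of_eventuallyLE (h : HasLeadingTerm d e f) (h' : HasLeadingTerm d e' f')
    (hle : f ≤ᶠ[atTop] f') : e ≤ e' := by
  refine le_of_tendsto_of_tendsto h.tendsto h'.tendsto ?_
  filter_upwards [hle, eventually_gt_atTop 0] with t ht ht0
  have : (0 : ℚ) < (t : ℚ) ^ d := pow_pos (by exact_mod_cast ht0) d
  gcongr

theorem degree_le {d' : ℕ} (he : 0 < e) (h : HasLeadingTerm d e f) (h' : HasLeadingTerm d' e' f')
    (hle : f ≤ᶠ[atTop] f') : d ≤ d' := by
  by_contra! hlt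
  exact he.not_ge (h.le_of_eventuallyLE (h'.of_lt hlt) hle)

end HasLeadingTerm

/-- `f` vanishes identically or is the function of a quasi-polynomial with a positive constant
leading coefficient: unlike `∃ d e, HasLeadingTerm d e f`, this property passes to sums. -/
def HasPosLeadingTerm (f : ℤ → ℚ) : Prop :=
  f = 0 ∨ ∃ d e, 0 < e ∧ HasLeadingTerm d e f

namespace HasPosLeadingTerm

variable {f f' : ℤ → ℚ}

theorem add (h : HasPosLeadingTerm f) (h' : HasPosLeadingTerm f') : HasPosLeadingTerm (f + f') := by
  obtain rfl | ⟨d, e, he, hf⟩ := h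
  · rwa [zero_add]
  obtain rfl | ⟨d', e', he', hf'⟩ := h'
  · rw [add_zero]
    exact .inr ⟨d, e, he, hf⟩
  rcases lt_trichotomy d d' with hlt | rfl | hlt
  · exact .inr ⟨d', 0 + e', by positivity, (hf.of_lt hlt).add hf'⟩
  · exact .inr ⟨d, e + e', by positivity, hf.add hf'⟩
  · exact .inr ⟨d, e + 0, by positivity, hf.add (hf'.of_lt hlt)⟩

theorem shift_pow (h : HasPosLeadingTerm f) (n : ℕ) : HasPosLeadingTerm ((shift ^ n) f) := by
  obtain rfl | ⟨d, e, he, hf⟩ := h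
  · exact .inl (map_zero _)
  · exact .inr ⟨d, e, he, hf.shift_pow n⟩

theorem exists_leadingCoeff_eq {Φ : QuasiPolynomial} (h : HasPosLeadingTerm (evalAt Φ))
    (hΦ : Φ ≠ 0) : ∃ e, 0 < e ∧ Φ.leadingCoeff = algebraMap ℚ periodicNumber e ∧
      HasLeadingTerm Φ.natDegree e (evalAt Φ) := by
  obtain h0 | ⟨d, e, he, Ψ, hd, hΨe, hΨ⟩ := h
  · exact absurd (eq_zero_of_evalAt_eventuallyEq (.of_eq h0)) hΦ
  · obtain rfl : Ψ = Φ := eq_of_evalAt_eventuallyEq (.of_eq hΨ)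
    have hne : Ψ.coeff d ≠ 0 := by
      rw [hΨe]
      exact (map_ne_zero_iff _ (algebraMap ℚ periodicNumber).injective).2 he.ne'
    obtain rfl : Ψ.natDegree = d := natDegree_eq_of_le_of_coeff_ne_zero hd hne
    exact ⟨e, he, hΨe, Ψ, hd, hΨe, rfl⟩

theorem exists_leadingCoeff_eq_algebraMap {Φ : QuasiPolynomial} (h : HasPosLeadingTerm (evalAt Φ)) :
    ∃ e : ℚ, Φ.leadingCoeff = algebraMap ℚ periodicNumber e := by
  rcases eq_or_ne Φ 0 with rfl | hΦ
  · exact ⟨0, by rw [leadingCoeff_zero, map_zero]⟩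
  · obtain ⟨e, -, he, -⟩ := h.exists_leadingCoeff_eq hΦ
    exact ⟨e, he⟩

theorem degree_eq_and_leadingCoeff_eq {Φ Ψ : QuasiPolynomial} (hΦ : HasPosLeadingTerm (evalAt Φ))
    (hΨ : HasPosLeadingTerm (evalAt Ψ)) {c c' : ℕ} (h : (shift ^ c) (evalAt Φ) ≤ᶠ[atTop] evalAt Ψ)
    (h' : (shift ^ c') (evalAt Ψ) ≤ᶠ[atTop] evalAt Φ) :
    Φ.degree = Ψ.degree ∧ Φ.leadingCoeff = Ψ.leadingCoeff := by
  have hzero (d : ℕ) : HasLeadingTerm d 0 (evalAt 0) :=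
    ⟨0, by simp, by simp, rfl⟩
  rcases eq_or_ne Φ 0 with rfl | hΦ0 <;> rcases eq_or_ne Ψ 0 with rfl | hΨ0
  · exact ⟨rfl, rfl⟩
  · obtain ⟨e', he', -, hf'⟩ := hΨ.exists_leadingCoeff_eq hΨ0
    exact absurd ((hf'.shift_pow c').le_of_eventuallyLE (hzero _) h') he'.not_ge
  · obtain ⟨e, he, -, hf⟩ := hΦ.exists_leadingCoeff_eq hΦ0
    exact absurd ((hf.shift_pow c).le_of_eventuallyLE (hzero _) h) he.not_ge
  · obtain ⟨e, he, hlead, hf⟩ := hΦ.exists_leadingCoeff_eq hΦ0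
    obtain ⟨e', he', hlead', hf'⟩ := hΨ.exists_leadingCoeff_eq hΨ0
    have hdeg : Φ.natDegree = Ψ.natDegree :=
      ((hf.shift_pow c).degree_le he hf' h).antisymm ((hf'.shift_pow c').degree_le he' hf h')
    rw [hdeg] at hf
    have hcoeff : e = e' := ((hf.shift_pow c).le_of_eventuallyLE hf' h).antisymm
      ((hf'.shift_pow c').le_of_eventuallyLE hf h')
    exact ⟨by rw [degree_eq_natDegree hΦ0, degree_eq_natDegree hΨ0, hdeg],
      by rw [hlead, hlead', hcoeff]⟩

end HasPosLeadingTerm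

/-! ### Counting exponents outside an upper set -/

section Counting

variable {m : ℕ} {w : Fin m → ℕ}

theorem weightedOrder_add (w k l : Fin m → ℕ) :
    weightedOrder w (k + l) = weightedOrder w k + weightedOrder w l := by
  simp only [weightedOrder, Pi.add_apply, mul_add, Finset.sum_add_distrib]

theorem weightedOrder_single (w : Fin m → ℕ) (j : Fin m) :
    weightedOrder w (Pi.single j 1) = w j := by
  simp [weightedOrder, Pi.single_apply]

theorem finite_weightedOrder_le (hw : ∀ i, 0 < w i) (t : ℤ) :
    {k : Fin m → ℕ | (weightedOrder w k : ℤ) ≤ t}.Finite := by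
  refine (Set.finite_Iic fun _ : Fin m => t.toNat).subset fun k (hk : _ ≤ t) i => ?_
  have hle : k i ≤ weightedOrder w k := (Nat.le_mul_of_pos_left _ (hw i)).trans
    (Finset.single_le_sum (f := fun i => w i * k i) (fun _ _ => Nat.zero_le _) (Finset.mem_univ i))
  change k i ≤ t.toNat
  lia

theorem sub_single_add_single {k : Fin m → ℕ} {j : Fin m} (hj : k j ≠ 0) :
    k - Pi.single j 1 + Pi.single j 1 = k :=
  tsub_add_cancel_of_le fun i => by
    rcases eq_or_ne i j with rfl | hij
    · simpa [Nat.one_le_iff_ne_zero] using hj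
    · simp [hij]

/-- The number of exponent vectors of weighted order at most `t` outside `E`, as a function
of `t`. -/
noncomputable def complCount (w : Fin m → ℕ) (E : Set (Fin m → ℕ)) (t : ℤ) : ℚ :=
  ({k | k ∉ E ∧ (weightedOrder w k : ℤ) ≤ t}.ncard : ℚ)

theorem complCount_of_neg (w : Fin m → ℕ) (E : Set (Fin m → ℕ)) {t : ℤ} (ht : t < 0) :
    complCount w E t = 0 := by
  have : {k | k ∉ E ∧ (weightedOrder w k : ℤ) ≤ t} = ∅ :=
    Set.eq_empty_of_forall_notMem fun k hk => by have := hk.2; lia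
  rw [complCount, this, Set.ncard_empty, Nat.cast_zero]

theorem complCount_univ (w : Fin m → ℕ) : complCount w Set.univ = 0 := by
  funext t
  simp [complCount]

/-- Splitting off the exponents with `k j = 0`: the others are `Pi.single j 1` plus an exponent
outside the colon set of `E`. -/
theorem complCount_eq_add_shift (hw : ∀ i, 0 < w i) (E : Set (Fin m → ℕ)) (j : Fin m) :
    complCount w E = complCount w (E ∪ {k | k j ≠ 0}) +
      (shift ^ w j) (complCount w ((· + Pi.single j 1) ⁻¹' E)) := by
  funext t
  have hsplit : {k | k ∉ E ∧ (weightedOrder w k : ℤ) ≤ t} =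
      {k | k ∉ E ∪ {k | k j ≠ 0} ∧ (weightedOrder w k : ℤ) ≤ t} ∪
        (· + Pi.single j 1) '' {k | k ∉ (· + Pi.single j 1) ⁻¹' E ∧
          (weightedOrder w k : ℤ) ≤ t - w j} := by
    ext k
    constructor
    · rintro ⟨hkE, hkt⟩
      by_cases hkj : k j = 0
      · exact .inl ⟨by simp [hkE, hkj], hkt⟩
      · have hk : k - Pi.single j 1 + Pi.single j 1 = k :=
          sub_single_add_single hkj
        refine .inr ⟨k - Pi.single j 1, ⟨by simpa [hk] using hkE, ?_⟩, hk⟩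
        rw [← hk, weightedOrder_add, weightedOrder_single] at hkt
        push_cast at hkt
        linarith
    · rintro (⟨hkE, hkt⟩ | ⟨k, ⟨hkE, hkt⟩, rfl⟩)
      · exact ⟨fun h => hkE (.inl h), hkt⟩
      · refine ⟨hkE, ?_⟩
        rw [weightedOrder_add, weightedOrder_single]
        push_cast
        linarith
  have hdisj : Disjoint {k | k ∉ E ∪ {k | k j ≠ 0} ∧ (weightedOrder w k : ℤ) ≤ t}
      ((· + Pi.single j 1) '' {k | k ∉ (· + Pi.single j 1) ⁻¹' E ∧
        (weightedOrder w k : ℤ) ≤ t - w j}) := by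
    rw [Set.disjoint_left]
    rintro _ ⟨hk, -⟩ ⟨k, -, rfl⟩
    exact hk (.inr (by simp))
  rw [complCount, hsplit, Set.ncard_union_eq hdisj
    ((finite_weightedOrder_le hw t).subset fun k hk => hk.2)
    (((finite_weightedOrder_le hw (t - w j)).subset fun k hk => hk.2).image _),
    Set.ncard_image_of_injective _ (add_left_injective _), Nat.cast_add, Pi.add_apply,
    shift_pow_apply, complCount, complCount]

/-- The exponents not supported in `S`: the union of the upper sets `{k | k i ≠ 0}`, `i ∉ S`. -/
def offSupport (S : Finset (Fin m)) : Set (Fin m → ℕ) :=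
  {k | ∃ i ∉ S, k i ≠ 0}

theorem complCount_offSupport_insert_sub (hw : ∀ i, 0 < w i) {S : Finset (Fin m)} {j : Fin m}
    (hj : j ∉ S) :
    complCount w (offSupport (insert j S)) -
      (shift ^ w j) (complCount w (offSupport (insert j S))) = complCount w (offSupport S) := by
  have hcolon : (· + Pi.single j 1) ⁻¹' offSupport (insert j S) = offSupport (insert j S) := by
    ext k
    refine exists_congr fun i => and_congr_right fun hi => ?_
    beta_reduce
    rw [Pi.add_apply, Pi.single_eq_of_ne (by rintro rfl; simp at hi), add_zero]
  have hunion : offSupport (insert j S) ∪ {k | k j ≠ 0} = offSupport S := by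
    ext k
    simp only [offSupport, Set.mem_union, Set.mem_ofPred_eq, Finset.mem_insert, not_or]
    grind
  nth_rewrite 1 [complCount_eq_add_shift hw _ j]
  rw [hcolon, hunion, add_sub_cancel_right]

theorem wellFoundedLT_upperSet_of_wellQuasiOrderedLE (α : Type*) [Preorder α]
    [WellQuasiOrderedLE α] : WellFoundedLT (UpperSet α) := by
  refine ⟨RelEmbedding.wellFounded_iff_isEmpty.2 ⟨fun F => ?_⟩⟩
  have hF : StrictAnti F := fun i j hij => F.map_rel_iff.2 hij
  choose x hxmem hxnot using fun n => Set.exists_of_ssubset (UpperSet.coe_ssubset_coe.2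
    (hF (Nat.lt_succ_self n)))
  obtain ⟨i, j, hij, hle⟩ := wellQuasiOrdered_le x
  exact hxnot j ((F j).upper hle (hF.antitone (Nat.succ_le_of_lt hij) (hxmem i)))

theorem zero_mem_of_forall_sub_single_mem {E : Set (Fin m → ℕ)} {S : Set (Fin m)}
    (hE : ∀ j ∈ S, (· + Pi.single j 1) ⁻¹' E ⊆ E) {k : Fin m → ℕ} (hk : k ∈ E)
    (hkS : ∀ i, k i ≠ 0 → i ∈ S) : 0 ∈ E := by
  induction k using WellFoundedLT.induction with
  | _ k ih =>
    by_cases h0 : k = 0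
    · exact h0 ▸ hk
    obtain ⟨j, hj⟩ := Function.ne_iff.1 h0
    have hsub : k - Pi.single j 1 ≤ k := tsub_le_self
    refine ih _ (lt_of_le_of_ne hsub fun h => ?_) (hE j (hkS j hj) ?_)
      fun i hi => hkS i (pos_of_ne_zero hi |>.trans_le (hsub i)).ne'
    · have := congrFun (sub_single_add_single hj) j
      rw [h] at this
      simp at this
    · rwa [Set.mem_preimage, sub_single_add_single hj]

theorem eq_univ_or_eq_offSupport {E : Set (Fin m → ℕ)} (hE : IsUpperSet E)
    (h : ∀ j, {k | k j ≠ 0} ⊆ E ∨ (· + Pi.single j 1) ⁻¹' E ⊆ E) :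
    E = Set.univ ∨ ∃ S, E = offSupport S := by
  classical
  by_cases h0 : 0 ∈ E
  · exact .inl (Set.eq_univ_of_forall fun k => hE zero_le h0)
  refine .inr ⟨({j | ¬ {k : Fin m → ℕ | k j ≠ 0} ⊆ E} : Finset (Fin m)),
    Set.Subset.antisymm (fun k hk => ?_) ?_⟩
  · by_contra hkS
    refine h0 (zero_mem_of_forall_sub_single_mem (S := {j | ¬ {k : Fin m → ℕ | k j ≠ 0} ⊆ E})
      (fun j hj => (h j).resolve_left hj) hk fun i hi => ?_)
    by_contra hiS
    exact hkS ⟨i, by simpa using hiS, hi⟩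
  · rintro k ⟨i, hi, hki⟩
    simp only [Finset.mem_filter_univ, not_not] at hi
    exact hi hki

theorem complCount_mem_of_offSupport_mem (hw : ∀ i, 0 < w i) {A : AddSubmonoid (ℤ → ℚ)}
    (hshift : ∀ c : ℕ, ∀ f ∈ A, (shift ^ c) f ∈ A)
    (hA : ∀ S ≠ Finset.univ, complCount w (offSupport S) ∈ A) (E : UpperSet (Fin m → ℕ))
    (hE : (E : Set (Fin m → ℕ)).Nonempty) : complCount w E ∈ A := by
  have := wellFoundedLT_upperSet_of_wellQuasiOrderedLE (Fin m → ℕ)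
  induction E using WellFoundedLT.induction with
  | _ E ih =>
    by_cases h : ∀ j, {k | k j ≠ 0} ⊆ (E : Set (Fin m → ℕ)) ∨
        (· + Pi.single j 1) ⁻¹' (E : Set (Fin m → ℕ)) ⊆ (E : Set (Fin m → ℕ))
    · obtain hE' | ⟨S, hS⟩ := eq_univ_or_eq_offSupport E.upper h
      · rw [hE', complCount_univ]
        exact A.zero_mem
      · rw [hS]
        refine hA S ?_
        rintro rfl
        simp [hS, offSupport] at hE
    push Not at h
    obtain ⟨j, hsupp, hcolon⟩ := h
    let F : UpperSet (Fin m → ℕ) := ⟨E ∪ {k | k j ≠ 0}, E.upper.union fun k l hkl hk =>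
      (pos_of_ne_zero hk |>.trans_le (hkl j)).ne'⟩
    let G : UpperSet (Fin m → ℕ) := ⟨(· + Pi.single j 1) ⁻¹' E, fun k l hkl hk =>
      E.upper (add_le_add_left hkl _) hk⟩
    have hEF : (E : Set (Fin m → ℕ)) ⊆ F := Set.subset_union_left
    have hEG : (E : Set (Fin m → ℕ)) ⊆ G := fun k hk => E.upper le_self_add hk
    rw [complCount_eq_add_shift hw _ j]
    refine add_mem (ih F (UpperSet.coe_ssubset_coe.1 ?_) (hE.mono hEF))
      (hshift _ _ (ih G (UpperSet.coe_ssubset_coe.1 ?_) (hE.mono hEG)))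
    · exact hEF.ssubset_of_not_subset fun h => hsupp (Set.subset_union_right.trans h)
    · exact hEG.ssubset_of_not_subset hcolon

end Counting

/-! ### The quasi-polynomials counting the points of conic polytopes -/

/-- For `t ≥ 0` the number of `k : Fin d → ℕ` with `∑ i, W * k i ≤ t`, that is, the count with all
weights equal to `W`. The values at `t < 0` are those of the same quasi-polynomial. -/
def equalWeightCount (W d : ℕ) (t : ℤ) : ℚ :=
  (Ring.multichoose (t / W + 1) d : ℤ)

theorem equalWeightCount_zero (W : ℕ) : equalWeightCount W 0 = 1 := by
  funext t
  simp [equalWeightCount]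

section

variable {W : ℕ}

theorem equalWeightCount_succ_sub (hW : 0 < W) (d : ℕ) :
    equalWeightCount W (d + 1) - (shift ^ W) (equalWeightCount W (d + 1)) =
      equalWeightCount W d := by
  funext t
  have hdiv : (t - W) / W = t / W - 1 := Int.sub_ediv_of_dvd t (dvd_refl (W : ℤ)) |>.trans
    (by rw [Int.ediv_self (by exact_mod_cast hW.ne')])
  simp only [Pi.sub_apply, shift_pow_apply, equalWeightCount, hdiv, sub_add_cancel,
    Ring.multichoose_succ_succ (t / W : ℤ) d]
  push_cast
  ring

theorem equalWeightCount_eq_zero (hW : 0 < W) {d : ℕ} {t : ℤ} (h : -(d * W : ℕ) ≤ t)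
    (ht : t < 0) : equalWeightCount W d t = 0 := by
  have hW' : (0 : ℤ) < W := by exact_mod_cast hW
  have hneg : t / W < 0 := Int.ediv_neg_of_neg_of_pos ht hW'
  have hle : -(d : ℤ) ≤ t / W := (Int.le_ediv_iff_mul_le hW').2 (by push_cast at h; linarith)
  obtain ⟨n, hn⟩ := Int.exists_eq_neg_ofNat (show t / W + 1 ≤ 0 by lia)
  rw [equalWeightCount, hn, Ring.multichoose_neg_of_lt n d (by lia), Int.cast_zero]

theorem equalWeightCount_eq_eval_ascPochhammer (W d : ℕ) (t : ℤ) :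
    equalWeightCount W d t = (d ! : ℚ)⁻¹ * (ascPochhammer ℚ d).eval ((t / W + 1 : ℤ) : ℚ) := by
  have h := Ring.factorial_nsmul_multichoose_eq_ascPochhammer (t / W + 1 : ℤ) d
  rw [ascPochhammer_smeval_eq_eval, nsmul_eq_mul] at h
  rw [equalWeightCount, eq_inv_mul_iff_mul_eq₀ (by positivity),
    ← ascPochhammer_map (Int.castRingHom ℚ) d, eval_intCast_map, Int.cast_id,
    ← h, map_mul, map_natCast, eq_intCast]

theorem hasLeadingTerm_equalWeightCount (hW : 0 < W) (d : ℕ) :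
    HasLeadingTerm d ((d ! : ℚ)⁻¹ * ((W : ℚ)⁻¹) ^ d) (equalWeightCount W d) := by
  let ρ : periodicNumber := ⟨fun t => 1 - ((t % W : ℤ) : ℚ) / W, W, hW, fun t => by simp⟩
  let κ (a : ℚ) : periodicNumber := algebraMap ℚ periodicNumber a
  have hW' : (W : ℚ) ≠ 0 := by positivity
  have hκ : κ (W : ℚ)⁻¹ ≠ 0 :=
    (map_ne_zero_iff _ (algebraMap ℚ periodicNumber).injective).2 (inv_ne_zero hW')
  have hlin : (C (κ (W : ℚ)⁻¹) * X + C ρ).natDegree = 1 := natDegree_linear hκ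
  have hmap := ascPochhammer_map (algebraMap ℚ periodicNumber) d
  have hmonic : (ascPochhammer periodicNumber d).Monic := hmap ▸ (monic_ascPochhammer ℚ d).map _
  have hdeg : (ascPochhammer periodicNumber d).natDegree = d := by
    rw [← hmap, (monic_ascPochhammer ℚ d).natDegree_map, ascPochhammer_natDegree]
  refine ⟨C (κ (d ! : ℚ)⁻¹) * (ascPochhammer periodicNumber d).comp (C (κ (W : ℚ)⁻¹) * X + C ρ),
    (natDegree_C_mul_le _ _).trans (natDegree_comp_le.trans (by rw [hlin, hdeg, mul_one])), ?_,
    funext fun t => ?_⟩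
  · have hcoeff := coeff_comp_degree_mul_degree (p := ascPochhammer periodicNumber d)
      (q := C (κ (W : ℚ)⁻¹) * X + C ρ) (by rw [hlin]; exact one_ne_zero)
    rw [hlin, hdeg, mul_one, hmonic.leadingCoeff, leadingCoeff_linear hκ,
      one_mul] at hcoeff
    rw [coeff_C_mul, hcoeff, map_mul, map_pow]
  · have hdiv : (W : ℚ)⁻¹ * t + (1 - ((t % W : ℤ) : ℚ) / W) = ((t / W + 1 : ℤ) : ℚ) := by
      have : (t : ℚ) = ((t % W : ℤ) : ℚ) + W * ((t / W : ℤ) : ℚ) := by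
        exact_mod_cast (Int.emod_add_mul_ediv t W).symm
      rw [this]
      push_cast
      field_simp
      ring
    rw [equalWeightCount_eq_eval_ascPochhammer, ← hdiv, evalAt, eval₂_mul, eval₂_C, eval₂_comp,
      ← ascPochhammer_eval₂, eval₂_add, eval₂_mul, eval₂_X, eval₂_C, eval₂_C]
    rfl

end

section Conic

variable {m : ℕ} {w : Fin m → ℕ}

/-- The polynomial `∏ i ∈ S, (1 - X ^ W) / (1 - X ^ w i)` with `W = ∏ i, w i`, relating the
generating function of the weights `w i`, `i ∈ S`, to that of equal weights `W`. -/
noncomputable def geomProd (w : Fin m → ℕ) (S : Finset (Fin m)) : ℚ[X] :=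
  ∏ i ∈ S, ∑ k ∈ Finset.range ((∏ j, w j) / w i), (X ^ w i) ^ k

theorem one_sub_mul_geomProd_insert (w : Fin m → ℕ) {S : Finset (Fin m)} {j : Fin m} (hj : j ∉ S) :
    (1 - X ^ w j) * geomProd w (insert j S) = (1 - X ^ ∏ i, w i) * geomProd w S := by
  rw [geomProd, Finset.prod_insert hj, ← mul_assoc, mul_neg_geom_sum, ← pow_mul,
    Nat.mul_div_cancel' (Finset.dvd_prod_of_mem w (Finset.mem_univ j)), geomProd]

theorem natDegree_geomProd_le (w : Fin m → ℕ) (S : Finset (Fin m)) :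
    (geomProd w S).natDegree ≤ S.card * ∏ i, w i := by
  refine (natDegree_prod_le _ _).trans (Finset.sum_le_card_nsmul _ _ _ fun i _ => ?_)
  refine natDegree_sum_le_of_forall_le _ _ fun k hk => ?_
  rw [← pow_mul, natDegree_X_pow]
  exact (Nat.mul_le_mul_left _ (Finset.mem_range.1 hk).le).trans (Nat.mul_div_le _ _)

theorem eval_one_geomProd (hw : ∀ i, 0 < w i) (S : Finset (Fin m)) :
    (geomProd w S).eval 1 = ∏ i ∈ S, ((∏ j, w j : ℕ) : ℚ) / w i := by
  rw [geomProd, eval_prod]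
  refine Finset.prod_congr rfl fun i _ => ?_
  rw [← Nat.cast_div (Finset.dvd_prod_of_mem w (Finset.mem_univ i))
    (by exact_mod_cast (hw i).ne')]
  simp [eval_finsetSum]

theorem aeval_shift_one_sub_X_pow_mul (n : ℕ) (P : ℚ[X]) (f : ℤ → ℚ) :
    aeval shift ((1 - X ^ n) * P) f = aeval shift P f - (shift ^ n) (aeval shift P f) := by
  simp [sub_mul]

/-- The quasi-polynomial counting the points of `ℕ ^ S` of weighted order at most `t`. -/
noncomputable def conicCount (w : Fin m → ℕ) (S : Finset (Fin m)) : ℤ → ℚ :=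
  aeval shift (geomProd w S) (equalWeightCount (∏ i, w i) S.card)

theorem conicCount_insert_sub (hw : ∀ i, 0 < w i) {S : Finset (Fin m)} {j : Fin m} (hj : j ∉ S) :
    conicCount w (insert j S) - (shift ^ w j) (conicCount w (insert j S)) = conicCount w S := by
  rw [conicCount, ← aeval_shift_one_sub_X_pow_mul, one_sub_mul_geomProd_insert w hj, mul_comm,
    map_mul, Module.End.mul_apply, Finset.card_insert_of_notMem hj]
  congr 1
  rw [map_sub, map_one, map_pow, aeval_X]
  exact equalWeightCount_succ_sub (Finset.prod_pos fun i _ => hw i) S.card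

theorem indicator_equalWeightCount_succ_sub {W : ℕ} (hW : 0 < W) (d : ℕ) :
    (Set.Ici 0).indicator (equalWeightCount W (d + 1)) -
        (shift ^ W) ((Set.Ici 0).indicator (equalWeightCount W (d + 1))) =
      (Set.Ici 0).indicator (equalWeightCount W d) := by
  funext t
  have h := congrFun (equalWeightCount_succ_sub hW d) t
  simp only [Pi.sub_apply, shift_pow_apply, Set.indicator_apply, Set.mem_Ici] at h ⊢
  by_cases ht : 0 ≤ t
  · rw [if_pos ht, if_pos ht, ← h]
    split_ifs with htW
    · rfl
    · rw [equalWeightCount_eq_zero hW (d := d + 1) (by push_cast; nlinarith) (not_le.1 htW)]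
  · rw [if_neg ht, if_neg ht, if_neg (by lia), sub_zero]

theorem complCount_offSupport_empty (w : Fin m → ℕ) :
    complCount w (offSupport ∅) = (Set.Ici 0).indicator 1 := by
  funext t
  by_cases ht : 0 ≤ t
  · have hzero : {k | k ∉ offSupport (∅ : Finset (Fin m)) ∧ (weightedOrder w k : ℤ) ≤ t} = {0} := by
      ext k
      simp only [offSupport, Finset.notMem_empty, not_false_eq_true, true_and, Set.mem_ofPred_eq,
        not_exists, not_not, Set.mem_singleton_iff]
      exact ⟨fun h => funext h.1, by rintro rfl; simpa [weightedOrder] using ht⟩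
    rw [complCount, hzero, Set.ncard_singleton, Set.indicator_of_mem (Set.mem_Ici.2 ht),
      Pi.one_apply, Nat.cast_one]
  · rw [complCount_of_neg w _ (not_le.1 ht), Set.indicator_of_notMem (mt Set.mem_Ici.1 ht)]

/-- Both sides vanish at negative integers and satisfy the same recursion, which determines them. -/
theorem complCount_offSupport_eq (hw : ∀ i, 0 < w i) (S : Finset (Fin m)) :
    complCount w (offSupport S) = aeval shift (geomProd w S)
      ((Set.Ici 0).indicator (equalWeightCount (∏ i, w i) S.card)) := by
  induction S using Finset.induction_on with
  | empty =>
    rw [complCount_offSupport_empty, geomProd, Finset.prod_empty, map_one, Module.End.one_apply,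
      Finset.card_empty, equalWeightCount_zero]
  | insert j S hj ih =>
    refine eq_of_sub_shift_pow_eq (hw j) (fun t ht => complCount_of_neg w _ ht) (fun t ht =>
      aeval_shift_eq_zero_of_neg _ (fun t ht => Set.indicator_of_notMem (not_le.2 ht) _) ht) ?_
    rw [complCount_offSupport_insert_sub hw hj, ih, ← aeval_shift_one_sub_X_pow_mul,
      one_sub_mul_geomProd_insert w hj, mul_comm, map_mul, Module.End.mul_apply,
      Finset.card_insert_of_notMem hj,
      ← indicator_equalWeightCount_succ_sub (Finset.prod_pos fun i _ => hw i)]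
    simp only [map_sub, map_one, map_pow, aeval_X, LinearMap.sub_apply, Module.End.one_apply]

theorem conicCount_eq_complCount (hw : ∀ i, 0 < w i) (S : Finset (Fin m)) {t : ℤ} (ht : 0 ≤ t) :
    conicCount w S t = complCount w (offSupport S) t := by
  rw [complCount_offSupport_eq hw]
  refine aeval_shift_congr (natDegree_geomProd_le w S) (fun s hs => ?_) ht
  by_cases h0 : 0 ≤ s
  · rw [Set.indicator_of_mem (Set.mem_Ici.2 h0)]
  · rw [Set.indicator_of_notMem (mt Set.mem_Ici.1 h0),
      equalWeightCount_eq_zero (Finset.prod_pos fun i _ => hw i) hs (not_le.1 h0)]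

theorem hasLeadingTerm_conicCount (hw : ∀ i, 0 < w i) (S : Finset (Fin m)) :
    HasLeadingTerm S.card (((S.card ! : ℚ) * ∏ i ∈ S, (w i : ℚ))⁻¹) (conicCount w S) := by
  have hW : 0 < ∏ i, w i := Finset.prod_pos fun i _ => hw i
  have : ((∏ i, w i : ℕ) : ℚ) ≠ 0 := by exact_mod_cast hW.ne'
  have h := (hasLeadingTerm_equalWeightCount hW S.card).aeval_shift (geomProd w S)
  rw [eval_one_geomProd hw, Finset.prod_div_distrib, Finset.prod_const] at h
  convert h using 1
  · rw [inv_pow]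
    field_simp
  · rfl

/-- The shifts of the Ehrhart quasi-polynomial of the conic polytope of `w` and their sums with
signs. -/
def ehrhartSpan (w : Fin m → ℕ) : AddSubgroup (ℤ → ℚ) :=
  AddSubgroup.closure (Set.range fun c : ℕ => (shift ^ c) (conicCount w Finset.univ))

theorem shift_pow_mem_ehrhartSpan {f : ℤ → ℚ} (hf : f ∈ ehrhartSpan w) (c : ℕ) :
    (shift ^ c) f ∈ ehrhartSpan w := by
  induction hf using AddSubgroup.closure_induction with
  | mem f hf =>
    obtain ⟨d, rfl⟩ := hf
    exact AddSubgroup.subset_closure ⟨c + d, LinearMap.congr_fun (pow_add shift c d) _⟩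
  | zero => exact (map_zero (shift ^ c)).symm ▸ zero_mem _
  | add f g _ _ hf hg => exact (map_add (shift ^ c) f g).symm ▸ add_mem hf hg
  | neg f _ hf => exact (map_neg (shift ^ c) f).symm ▸ neg_mem hf

theorem conicCount_mem_ehrhartSpan (hw : ∀ i, 0 < w i) (S : Finset (Fin m)) :
    conicCount w S ∈ ehrhartSpan w := by
  suffices ∀ T : Finset (Fin m), conicCount w Tᶜ ∈ ehrhartSpan w by simpa using this Sᶜ
  intro T
  induction T using Finset.induction_on with
  | empty =>
    rw [Finset.compl_empty]
    exact AddSubgroup.subset_closure ⟨0, rfl⟩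
  | insert j T hj ih =>
    have h := conicCount_insert_sub hw (Finset.notMem_erase j Tᶜ)
    rw [Finset.insert_erase (Finset.mem_compl.2 hj)] at h
    rw [Finset.compl_insert, ← h]
    exact sub_mem ih (shift_pow_mem_ehrhartSpan ih _)

theorem mem_dilate_conicPolytope_iff (w : Fin m → ℕ) {r : ℝ} (hr : 0 < r) (x : Fin m → ℝ) :
    x ∈ r • conicPolytope w ↔ (∀ j, 0 ≤ x j) ∧ ∑ i, (w i : ℝ) * x i ≤ r := by
  rw [Set.mem_smul_set_iff_inv_smul_mem₀ hr.ne']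
  simp only [conicPolytope, Set.mem_ofPred_eq, Pi.smul_apply, smul_eq_mul]
  refine and_congr (forall_congr' fun j => mul_nonneg_iff_of_pos_left (inv_pos.2 hr)) ?_
  simp only [mul_left_comm _ r⁻¹, ← Finset.mul_sum]
  rw [inv_mul_le_iff₀ hr, mul_one]

theorem latticeCount_conicPolytope (w : Fin m → ℕ) {r : ℕ} (hr : 1 ≤ r) :
    (latticeCount (conicPolytope w) r : ℚ) = complCount w ∅ r := by
  have hsum (k : Fin m → ℕ) : ∑ i, (w i : ℝ) * ((k i : ℤ) : ℝ) = (weightedOrder w k : ℝ) := by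
    simp [weightedOrder]
  have hset : {z : Fin m → ℤ | (fun i => (z i : ℝ)) ∈ (r : ℝ) • conicPolytope w} =
      (fun k i => (k i : ℤ)) '' {k | k ∉ (∅ : Set (Fin m → ℕ)) ∧ (weightedOrder w k : ℤ) ≤ r} := by
    ext z
    rw [Set.mem_ofPred_eq, mem_dilate_conicPolytope_iff w (by exact_mod_cast hr)]
    constructor
    · rintro ⟨hz, h⟩
      lift z to Fin m → ℕ using fun i => by exact_mod_cast hz i
      exact ⟨z, ⟨Set.notMem_empty z, by exact_mod_cast (hsum z).ge.trans h⟩, rfl⟩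
    · rintro ⟨k, ⟨-, h⟩, rfl⟩
      exact ⟨fun j => by positivity, (hsum k).le.trans (by exact_mod_cast h)⟩
  rw [latticeCount, hset, complCount,
    Set.ncard_image_of_injective _ fun k l h => funext fun i => Int.natCast_inj.1 (congrFun h i)]

theorem offSupport_univ : offSupport (Finset.univ : Finset (Fin m)) = ∅ := by
  simp [offSupport]

theorem isAlternatingEhrhartSum_of_mem_ehrhartSpan (hw : ∀ i, 0 < w i) {Φ : QuasiPolynomial}
    (hΦ : evalAt Φ ∈ ehrhartSpan w) : IsAlternatingEhrhartSum w Φ := by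
  obtain ⟨lam, -, -, hlam⟩ := hasLeadingTerm_conicCount hw Finset.univ
  refine ⟨lam, fun r hr => ?_, ?_⟩
  · rw [hlam, conicCount_eq_complCount hw _ (Nat.cast_nonneg r), offSupport_univ,
      latticeCount_conicPolytope w hr]
  rw [ehrhartSpan, ← AddSubgroup.mem_toAddSubmonoid, AddSubgroup.closure_toAddSubmonoid] at hΦ
  obtain ⟨l, hl, hsum⟩ := AddSubmonoid.exists_list_of_mem_closure hΦ
  have hterm (i : Fin l.length) : ∃ (ε : ℤˣ) (c : ℕ), ∀ t : ℤ,
      l[i] t = ((ε : ℤ) : ℚ) * evalAt lam (t - c) := by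
    rw [hlam]
    obtain ⟨c, hc⟩ | ⟨c, hc⟩ := hl _ (l.getElem_mem i.isLt)
    · refine ⟨1, c, fun t => ?_⟩
      simp [← hc, shift_pow_apply]
    · refine ⟨-1, c, fun t => ?_⟩
      simp [neg_eq_iff_eq_neg.1 hc.symm, shift_pow_apply]
  choose ε c hεc using hterm
  refine ⟨l.length, ε, c, fun t => ?_⟩
  rw [← hsum, ← Fin.sum_univ_getElem, Finset.sum_apply]
  exact Finset.sum_congr rfl fun i _ => hεc i t

end Conic

/-! ### Sums of counting functions of complements of upper sets -/

/-- `f` agrees at large integers with a quasi-polynomial in the span of the shifted Ehrhart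
quasi-polynomials, whose leading coefficient is a positive constant and whose coefficient of
`t ^ m` is `e`. -/
def IsEventuallyConic {m : ℕ} (w : Fin m → ℕ) (e : ℚ) (f : ℤ → ℚ) : Prop :=
  ∃ g ∈ ehrhartSpan w, HasLeadingTerm m e g ∧ HasPosLeadingTerm g ∧ f =ᶠ[atTop] g

namespace IsEventuallyConic

variable {m : ℕ} {w : Fin m → ℕ} {e e' : ℚ} {f f' : ℤ → ℚ}

theorem zero (w : Fin m → ℕ) : IsEventuallyConic w 0 0 :=
  ⟨0, zero_mem _, .zero m, .inl rfl, .rfl⟩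

theorem add (h : IsEventuallyConic w e f) (h' : IsEventuallyConic w e' f') :
    IsEventuallyConic w (e + e') (f + f') := by
  obtain ⟨g, hg, hlead, hpos, hfg⟩ := h
  obtain ⟨g', hg', hlead', hpos', hfg'⟩ := h'
  exact ⟨g + g', add_mem hg hg', hlead.add hlead', hpos.add hpos', hfg.add hfg'⟩

theorem shift_pow (h : IsEventuallyConic w e f) (c : ℕ) :
    IsEventuallyConic w e ((shift ^ c) f) := by
  obtain ⟨g, hg, hlead, hpos, hfg⟩ := h
  exact ⟨_, shift_pow_mem_ehrhartSpan hg c, hlead.shift_pow c, hpos.shift_pow c,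
    shift_pow_congr hfg c⟩

theorem sum {ι : Type*} (s : Finset ι) {e : ι → ℚ} {f : ι → ℤ → ℚ}
    (h : ∀ i ∈ s, IsEventuallyConic w (e i) (f i)) :
    IsEventuallyConic w (∑ i ∈ s, e i) (∑ i ∈ s, f i) := by
  induction s using Finset.cons_induction with
  | empty => simpa using zero w
  | cons i s hi ih =>
    rw [Finset.sum_cons, Finset.sum_cons]
    exact (h i (Finset.mem_cons_self i s)).add (ih fun j hj => h j (Finset.mem_cons_of_mem hj))

theorem complCount_offSupport (hw : ∀ i, 0 < w i) (S : Finset (Fin m))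
    (h : HasLeadingTerm m e (conicCount w S)) :
    IsEventuallyConic w e (complCount w (offSupport S)) := by
  refine ⟨_, conicCount_mem_ehrhartSpan hw S, h,
    .inr ⟨_, _, ?_, hasLeadingTerm_conicCount hw S⟩, ?_⟩
  · have := Finset.prod_pos fun i (_ : i ∈ S) => Nat.cast_pos (α := ℚ).2 (hw i)
    positivity
  · filter_upwards [eventually_ge_atTop 0] with t ht
    exact (conicCount_eq_complCount hw S ht).symm

end IsEventuallyConic

section

variable {m : ℕ} {w : Fin m → ℕ}

theorem isEventuallyConic_complCount_empty (hw : ∀ i, 0 < w i) :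
    IsEventuallyConic w ((m ! : ℚ) * ∏ i, (w i : ℚ))⁻¹ (complCount w ∅) := by
  have h := hasLeadingTerm_conicCount hw Finset.univ
  rw [Finset.card_fin] at h
  exact offSupport_univ (m := m) ▸ .complCount_offSupport hw Finset.univ h

theorem isEventuallyConic_complCount_of_nonempty (hw : ∀ i, 0 < w i) (E : UpperSet (Fin m → ℕ))
    (hE : (E : Set (Fin m → ℕ)).Nonempty) : IsEventuallyConic w 0 (complCount w E) := by
  let A : AddSubmonoid (ℤ → ℚ) :=
    { carrier := {f | IsEventuallyConic w 0 f}
      add_mem' := fun h h' => add_zero (0 : ℚ) ▸ h.add h'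
      zero_mem' := .zero w }
  refine complCount_mem_of_offSupport_mem hw (A := A) (fun c f hf => hf.shift_pow c)
    (fun S hS => .complCount_offSupport hw S ((hasLeadingTerm_conicCount hw S).of_lt ?_)) E hE
  simpa using Finset.card_lt_card (Finset.ssubset_univ_iff.2 hS)

theorem exists_quasiPolynomial_sum_complCount (hw : ∀ i, 0 < w i) {J : Type*} [Fintype J]
    (E : J → UpperSet (Fin m → ℕ)) (c : J → ℕ) :
    ∃ Φ : QuasiPolynomial, evalAt Φ =ᶠ[atTop] ∑ j, (shift ^ c j) (complCount w (E j)) ∧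
      Φ.degree ≤ m ∧ IsAlternatingEhrhartSum w Φ ∧ HasPosLeadingTerm (evalAt Φ) ∧
      Φ.coeff m = algebraMap ℚ periodicNumber
        ({j | (E j : Set (Fin m → ℕ)) = ∅}.ncard / ((m ! : ℚ) * ∏ i, (w i : ℚ))) := by
  classical
  have hterm (j : J) : IsEventuallyConic w
      (if (E j : Set (Fin m → ℕ)) = ∅ then ((m ! : ℚ) * ∏ i, (w i : ℚ))⁻¹ else 0)
      ((shift ^ c j) (complCount w (E j))) := by
    refine .shift_pow ?_ _
    split_ifs with hE
    · exact hE ▸ isEventuallyConic_complCount_empty hw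
    · exact isEventuallyConic_complCount_of_nonempty hw _ (Set.nonempty_iff_ne_empty.2 hE)
  obtain ⟨_, hmem, ⟨Φ, hdeg, hcoeff, rfl⟩, hpos, heq⟩ :=
    IsEventuallyConic.sum Finset.univ fun j _ => hterm j
  refine ⟨Φ, heq.symm, degree_le_of_natDegree_le hdeg,
    isAlternatingEhrhartSum_of_mem_ehrhartSpan hw hmem, hpos, hcoeff.trans ?_⟩
  rw [← Finset.sum_filter, Finset.sum_const, nsmul_eq_mul, div_eq_mul_inv,
    Set.ncard_eq_toFinset_card', Set.toFinset_ofPred]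

end

/-! ### Algebraic dependence -/

section AlgebraicDependence

open AlgebraicIndependent (matroid matroid_closure_eq matroid_isBasis_iff)

variable {K L : Type*} [Field K] [Field L] [Algebra K L]

theorem isTranscendenceBasis_of_isBasis_matroid {E : IntermediateField K L} {B : Set L}
    (hB : (matroid K L).IsBasis B E) :
    IsTranscendenceBasis K fun b : B => (⟨b, hB.subset b.2⟩ : E) := by
  refine ⟨AlgebraicIndependent.of_comp E.val hB.indep, fun s hs hle => ?_⟩
  have hs' : (matroid K L).Indep (Subtype.val '' s) := by
    have h : AlgebraicIndepOn K E.val s := AlgebraicIndependent.map' hs E.val.injective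
    exact AlgebraicIndependent.image h
  have hBs : B = Subtype.val '' s := hB.eq_of_subset_indep hs'
    (fun b hb => ⟨⟨b, hB.subset hb⟩, hle ⟨⟨b, hb⟩, rfl⟩, rfl⟩)
    (by rintro _ ⟨e, -, rfl⟩; exact e.2)
  refine hle.antisymm fun e he => ?_
  have heB : (e : L) ∈ B := hBs ▸ Set.mem_image_of_mem _ he
  exact ⟨⟨e, heB⟩, rfl⟩

theorem trdeg_adjoin_of_isBasis_matroid {B S : Set L} (hB : (matroid K L).IsBasis B S) :
    Algebra.trdeg K (IntermediateField.adjoin K S) = Cardinal.mk B := by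
  have hle : (IntermediateField.adjoin K S : Set L) ⊆ (matroid K L).closure S := by
    intro x hx
    rw [matroid_closure_eq, SetLike.mem_coe, Subalgebra.mem_algebraicClosure,
      ← IntermediateField.isAlgebraic_adjoin_iff]
    exact isAlgebraic_algebraMap (⟨x, hx⟩ : IntermediateField.adjoin K S)
  have hBS : (matroid K L).IsBasis B (IntermediateField.adjoin K S) :=
    hB.isBasis_closure_right.isBasis_subset
      (hB.subset.trans (IntermediateField.subset_adjoin K S)) hle
  exact (isTranscendenceBasis_of_isBasis_matroid hBS).cardinalMk_eq_trdeg.symm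

variable {ι O : Type*} [LinearOrder O] {κ : ι → O} {x : ι → L}

variable (K) in
/-- `x i` is algebraic over `K` and the `x j` of smaller key. The other indices are those of the
transcendence basis chosen greedily in the order of the keys. -/
def IsDependent (κ : ι → O) (x : ι → L) (i : ι) : Prop :=
  IsAlgebraic (Algebra.adjoin K (x '' {j | κ j < κ i})) (x i)

theorem isAlgebraic_adjoin_mono {S T : Set L} (hST : S ⊆ T) {a : L}
    (ha : IsAlgebraic (Algebra.adjoin K S) a) : IsAlgebraic (Algebra.adjoin K T) a :=
  ha.adjoin_of_forall_isAlgebraic fun _ hx => absurd (hST hx.1) hx.2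

theorem algebraicIndepOn_not_isDependent (hκ : Function.Injective κ) (x : ι → L) :
    AlgebraicIndepOn K x {i | ¬ IsDependent K κ x i} := by
  classical
  have hfinset : ∀ s : Finset ι, (∀ i ∈ s, ¬ IsDependent K κ x i) →
      AlgebraicIndepOn K x (s : Set ι) := by
    intro s hs
    induction s using Finset.induction_on_max_value κ with
    | empty =>
      rw [Finset.coe_empty]
      exact algebraicIndependent_empty_type_iff.2 (algebraMap K L).injective
    | insert a s ha hmax ih =>
      rw [Finset.coe_insert]
      refine (ih fun i hi => hs i (Finset.mem_insert_of_mem hi)).insert fun halg => ?_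
      refine hs a (Finset.mem_insert_self a s)
        (isAlgebraic_adjoin_mono (Set.image_mono fun j hj => ?_) halg)
      exact lt_of_le_of_ne (hmax j hj) fun h => ha (hκ h ▸ hj)
  refine algebraicIndependent_of_finite_type fun t ht => ?_
  have h := hfinset (ht.toFinset.image Subtype.val) (by
    simp only [Finset.mem_image]
    rintro _ ⟨i, -, rfl⟩
    exact i.2)
  exact h.comp (fun a : t => ⟨a.1.1, Finset.mem_image_of_mem _ (ht.mem_toFinset.2 a.2)⟩)
    fun a b hab => by simpa [Subtype.ext_iff] using hab

theorem isAlgebraic_adjoin_not_isDependent [WellFoundedLT O] (κ : ι → O) (x : ι → L) (i : ι) :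
    IsAlgebraic (Algebra.adjoin K (x '' {j | ¬ IsDependent K κ x j ∧ κ j ≤ κ i})) (x i) := by
  induction i using (InvImage.wf κ wellFounded_lt).induction with
  | h i ih =>
    by_cases hi : IsDependent K κ x i
    · refine IsAlgebraic.adjoin_of_forall_isAlgebraic ?_ hi
      rintro _ ⟨⟨j, hj, rfl⟩, -⟩
      refine isAlgebraic_adjoin_mono (Set.image_mono ?_) (ih j hj)
      exact fun l hl => ⟨hl.1, hl.2.trans (le_of_lt hj)⟩
    · have hmem : x i ∈ x '' {j | ¬ IsDependent K κ x j ∧ κ j ≤ κ i} := ⟨i, ⟨hi, le_rfl⟩, rfl⟩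
      exact isAlgebraic_algebraMap
        (⟨x i, Algebra.subset_adjoin hmem⟩ : Algebra.adjoin K _)

theorem trdeg_adjoin_image [WellFoundedLT O] (hκ : Function.Injective κ) (x : ι → L) {s : Set ι}
    (hfin : s.Finite) (hs : ∀ i ∈ s, ∀ j, κ j < κ i → j ∈ s) :
    Algebra.trdeg K (IntermediateField.adjoin K (x '' s)) =
      ({i | ¬ IsDependent K κ x i ∧ i ∈ s}.ncard : Cardinal) := by
  set t := {i | ¬ IsDependent K κ x i ∧ i ∈ s}
  have hind : AlgebraicIndepOn K x t :=
    (algebraicIndepOn_not_isDependent hκ x).mono fun i hi => hi.1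
  have hbasis : (matroid K L).IsBasis (x '' t) (x '' s) := by
    refine matroid_isBasis_iff.2 ⟨AlgebraicIndependent.image hind,
      Set.image_mono fun i hi => hi.2, ?_⟩
    rintro _ ⟨i, hi, rfl⟩
    refine isAlgebraic_adjoin_mono (Set.image_mono ?_) (isAlgebraic_adjoin_not_isDependent κ x i)
    rintro j ⟨hj, hji⟩
    exact ⟨hj, hji.lt_or_eq.elim (hs i hi j) fun h => hκ h ▸ hi⟩
  have hfint : t.Finite := hfin.subset fun i hi => hi.2
  rw [trdeg_adjoin_of_isBasis_matroid hbasis, ← Set.cast_ncard (hfint.image x),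
    (Set.injOn_iff_injective.2 hind.injective).ncard_image]

end AlgebraicDependence

/-! ### Transforms -/

section SemilinearMap

variable {K L : Type*} [Field K] [Field L] [Algebra K L] {τ : K →+* K} {ψ : L →+* L}

theorem mapsTo_adjoin (h : Function.Semiconj (algebraMap K L) τ ψ) {S T : Set L}
    (hST : Set.MapsTo ψ S T) :
    Set.MapsTo ψ (IntermediateField.adjoin K S) (IntermediateField.adjoin K T) := by
  intro x hx
  induction hx using IntermediateField.adjoin_induction with
  | mem x hx => exact IntermediateField.subset_adjoin K T (hST hx)
  | algebraMap c => exact h c ▸ IntermediateField.algebraMap_mem _ (τ c)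
  | add x y _ _ hx hy => exact map_add ψ x y ▸ add_mem hx hy
  | inv x _ hx => exact map_inv₀ ψ x ▸ inv_mem hx
  | mul x y _ _ hx hy => exact map_mul ψ x y ▸ mul_mem hx hy

theorem isAlgebraic_adjoin_map (h : Function.Semiconj (algebraMap K L) τ ψ) {S T : Set L}
    (hST : Set.MapsTo ψ S T) {a : L} (ha : IsAlgebraic (Algebra.adjoin K S) a) :
    IsAlgebraic (Algebra.adjoin K T) (ψ a) := by
  rw [← IntermediateField.isAlgebraic_adjoin_iff] at ha ⊢
  let f : IntermediateField.adjoin K S →+* IntermediateField.adjoin K T :=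
    (ψ.comp (algebraMap (IntermediateField.adjoin K S) L)).codRestrict
      (IntermediateField.adjoin K T) fun y => mapsTo_adjoin h hST y.2
  exact ha.ringHom_of_comp_eq f ψ f.injective (RingHom.ext fun _ => rfl)

end SemilinearMap

theorem prod_ofFn_pow_add {M : Type*} [Monoid M] {m : ℕ} {a : Fin m → M}
    (ha : ∀ i j, Commute (a i) (a j)) (k l : Fin m → ℕ) :
    (List.ofFn fun i => a i ^ (k i + l i)).prod =
      (List.ofFn fun i => a i ^ k i).prod * (List.ofFn fun i => a i ^ l i).prod := by
  induction m with
  | zero => simp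
  | succ m ih =>
    have hcomm : Commute (a 0 ^ l 0) (List.ofFn fun i : Fin m => a i.succ ^ k i.succ).prod := by
      refine Commute.list_prod_right _ _ fun b hb => ?_
      obtain ⟨i, rfl⟩ := (List.mem_ofFn' _ _).1 hb
      exact (ha 0 i.succ).pow_pow _ _
    simp only [List.ofFn_succ, List.prod_cons]
    rw [ih fun i j => ha i.succ j.succ, pow_add]
    simp only [mul_assoc]
    rw [hcomm.left_comm]

section Transform

variable {K L : Type*} [Field K] [Field L] [Algebra K L] {m : ℕ}
  {σK : Translations m K} {σL : Translations m L} {J : Type*}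

theorem Translations.transform_add (σ : Translations m L) (k l : Fin m → ℕ) (x : L) :
    σ.transform (k + l) x = σ.transform k (σ.transform l x) :=
  congrArg (fun f : L →+* L => f x)
    (prod_ofFn_pow_add (M := L →+* L) (a := σ.trans) σ.comm k l)

theorem IsDifferenceExtension.semiconj_transform (hext : IsDifferenceExtension σK σL)
    (k : Fin m → ℕ) :
    Function.Semiconj (algebraMap K L) (σK.transform k) (σL.transform k) := by
  rw [Translations.transform, Translations.transform, List.ofFn_eq_map, List.ofFn_eq_map]
  induction List.finRange m with
  | nil => exact Function.Semiconj.id_right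
  | cons i l ih =>
    have htrans : Function.Semiconj (algebraMap K L) (σK.trans i) (σL.trans i) :=
      fun x => (hext i x).symm
    have hpow := htrans.iterate_right (k i)
    rw [← RingHom.coe_pow, ← RingHom.coe_pow] at hpow
    simpa only [List.map_cons, List.prod_cons, RingHom.coe_mul] using hpow.comp_right ih

/-- The family of all transforms of the elements of the family `ξ`. -/
def transforms (σ : Translations m L) (ξ : J → L) (p : (Fin m → ℕ) × J) : L :=
  σ.transform p.1 (ξ p.2)

/-- A key ordering the transforms of a family, first by the weighted order raised by offsets `d`.
It is strictly monotone under translations. -/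
noncomputable def transformKey [Finite J] (w : Fin m → ℕ) (d : J → ℕ) (p : (Fin m → ℕ) × J) :
    ℕ ×ₗ (Lex (Fin m → ℕ) ×ₗ ℕ) :=
  toLex (weightedOrder w p.1 + d p.2, toLex (toLex p.1, (Finite.equivFin J p.2 : ℕ)))

variable [Finite J] {w : Fin m → ℕ} {d : J → ℕ}

theorem transformKey_injective : Function.Injective (transformKey w d) := by
  rintro ⟨k, j⟩ ⟨k', j'⟩ h
  have h' := congrArg (fun a => ofLex (ofLex a).2) h
  simpa only [transformKey, ofLex_toLex, Prod.mk.injEq, EmbeddingLike.apply_eq_iff_eq,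
    Fin.val_inj] using h'

theorem transformKey_add_lt {p q : (Fin m → ℕ) × J} (l : Fin m → ℕ)
    (h : transformKey w d p < transformKey w d q) :
    transformKey w d (l + p.1, p.2) < transformKey w d (l + q.1, q.2) := by
  simp only [transformKey, Prod.Lex.toLex_lt_toLex, weightedOrder_add] at h ⊢
  rcases h with h | ⟨h, hk | ⟨hk, hj⟩⟩
  · exact Or.inl (by omega)
  · exact Or.inr ⟨by omega, Or.inl (add_lt_add_right hk (toLex l))⟩
  · exact Or.inr ⟨by omega, Or.inr ⟨by rw [toLex.injective hk], hj⟩⟩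

theorem weightedOrder_add_le_of_transformKey_lt {p q : (Fin m → ℕ) × J}
    (h : transformKey w d p < transformKey w d q) :
    weightedOrder w p.1 + d p.2 ≤ weightedOrder w q.1 + d q.2 := by
  simp only [transformKey, Prod.Lex.toLex_lt_toLex] at h
  omega

end Transform

/-! ### Leading exponents -/

section Leading

variable {K L : Type*} [Field K] [Field L] [Algebra K L] {m : ℕ}
  {σK : Translations m K} {σL : Translations m L} {J : Type*} {w : Fin m → ℕ}

/-- The field generated by the transforms of a family `ξ` of weighted order, raised by the offsets
`d`, at most `r`. -/
def offsetTruncation (K : Type*) {L : Type*} [Field K] [Field L] [Algebra K L] {m : ℕ}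
    (σ : Translations m L) (w : Fin m → ℕ) {J : Type*} (ξ : J → L) (d : J → ℕ) (r : ℕ) :
    IntermediateField K L :=
  IntermediateField.adjoin K (transforms σ ξ '' {p | weightedOrder w p.1 + d p.2 ≤ r})

/-- The exponents of the transforms of `ξ j` which are algebraic over the preceding transforms of
the family `ξ`. As translations preserve dependence and order, they form an upper set. -/
def dependentExponents [Finite J] (hext : IsDifferenceExtension σK σL) (w : Fin m → ℕ)
    (ξ : J → L) (d : J → ℕ) (j : J) : UpperSet (Fin m → ℕ) where
  carrier := {k | IsDependent K (transformKey w d) (transforms σL ξ) (k, j)}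
  upper' := by
    intro k k' hkk' hk
    obtain ⟨l, rfl⟩ : ∃ l, k' = l + k := ⟨k' - k, (tsub_add_cancel_of_le hkk').symm⟩
    have hadd (p : (Fin m → ℕ) × J) :
        transforms σL ξ (l + p.1, p.2) = σL.transform l (transforms σL ξ p) :=
      σL.transform_add l p.1 (ξ p.2)
    rw [Set.mem_ofPred_eq, IsDependent, hadd (k, j)]
    refine isAlgebraic_adjoin_map (hext.semiconj_transform l) ?_ hk
    rintro _ ⟨p, hp, rfl⟩
    exact ⟨(l + p.1, p.2), transformKey_add_lt l hp, hadd p⟩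

variable [Finite J] (hext : IsDifferenceExtension σK σL) (ξ : J → L) (d : J → ℕ)

theorem algebraicIndepOn_notMem_dependentExponents (w : Fin m → ℕ) :
    AlgebraicIndepOn K (transforms σL ξ) {p | p.1 ∉ dependentExponents hext w ξ d p.2} :=
  algebraicIndepOn_not_isDependent transformKey_injective _

variable {ξ d} in
theorem notMem_dependentExponents {r : ℕ}
    (hind : AlgebraicIndepOn K (transforms σL ξ) {p | weightedOrder w p.1 + d p.2 ≤ r})
    {k : Fin m → ℕ} {j : J} (hkj : weightedOrder w k + d j ≤ r) :
    k ∉ dependentExponents hext w ξ d j := by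
  intro hdep
  set s := {p | transformKey w d p < transformKey w d (k, j)}
  have hsub : insert (k, j) s ⊆ {p | weightedOrder w p.1 + d p.2 ≤ r} :=
    Set.insert_subset hkj fun p hp => (weightedOrder_add_le_of_transformKey_lt hp).trans hkj
  have hkjs : (k, j) ∉ s := lt_irrefl (transformKey w d (k, j))
  exact ((AlgebraicIndepOn.insert_iff hkjs).1 (hind.mono hsub)).2 hdep

theorem finite_weightedOrder_add_le (hw : ∀ i, 0 < w i) (d : J → ℕ) (r : ℕ) :
    {p : (Fin m → ℕ) × J | weightedOrder w p.1 + d p.2 ≤ r}.Finite := by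
  refine ((finite_weightedOrder_le hw r).prod (Set.finite_univ (α := J))).subset fun p hp => ?_
  have hp' : weightedOrder w p.1 + d p.2 ≤ r := hp
  exact ⟨by simp only [Set.mem_ofPred_eq]; omega, Set.mem_univ _⟩

theorem ncard_eq_sum_complCount {J : Type*} [Fintype J] (hw : ∀ i, 0 < w i)
    (E : J → Set (Fin m → ℕ)) (d : J → ℕ) (r : ℕ) :
    ({p : (Fin m → ℕ) × J | p.1 ∉ E p.2 ∧ weightedOrder w p.1 + d p.2 ≤ r}.ncard : ℚ) =
      ∑ j, (shift ^ d j) (complCount w (E j)) r := by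
  let S (j : J) : Set (Fin m → ℕ) := {k | k ∉ E j ∧ weightedOrder w k + d j ≤ r}
  have hS (j : J) : (shift ^ d j) (complCount w (E j)) r = Nat.card (S j) := by
    rw [shift_pow_apply, complCount, Nat.card_coe_set_eq]
    simp only [S, le_sub_iff_add_le]
    norm_cast
  have hfin (j : J) : Finite (S j) :=
    ((finite_weightedOrder_le hw r).subset fun k hk => by
      simp only [S, Set.mem_ofPred_eq] at hk ⊢
      omega).to_subtype
  simp only [hS]
  rw [← Nat.cast_sum, ← Nat.card_sigma, ← Nat.card_coe_set_eq]
  exact congrArg Nat.cast (Nat.card_congr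
    { toFun := fun p => ⟨p.1.2, p.1.1, p.2⟩
      invFun := fun a => ⟨(a.2.1, a.1), a.2.2⟩ })

end Leading

/-! ### Dimension functions -/

section DimensionFunction

variable {K L : Type*} [Field K] [Field L] [Algebra K L] {m : ℕ}
  {σK : Translations m K} {σL : Translations m L} {J J' : Type*} {w : Fin m → ℕ}

/-- The function `r ↦ trdeg_K` of the field generated by the transforms of `ξ` of weighted order,
raised by the offsets `d`, at most `r`, in terms of the dependent exponents. -/
noncomputable def dimensionFunction [Fintype J] (hext : IsDifferenceExtension σK σL)
    (w : Fin m → ℕ) (ξ : J → L) (d : J → ℕ) : ℤ → ℚ :=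
  ∑ j, (shift ^ d j) (complCount w (dependentExponents hext w ξ d j))

/-- The indices of the members of the family `ξ` without dependent exponents. -/
def freeIndices [Finite J] (hext : IsDifferenceExtension σK σL) (w : Fin m → ℕ) (ξ : J → L)
    (d : J → ℕ) : Set J :=
  {j | (dependentExponents hext w ξ d j : Set (Fin m → ℕ)) = ∅}

theorem algebraicIndepOn_range_iff {ι ι' : Type*} {x : ι → L} {f : ι' → ι} (hf : f.Injective) :
    AlgebraicIndepOn K x (Set.range f) ↔ AlgebraicIndependent K (x ∘ f) :=
  (algebraicIndependent_equiv (Equiv.ofInjective f hf)).symm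

theorem algebraicIndependent_transforms_freeIndices [Finite J]
    (hext : IsDifferenceExtension σK σL) (w : Fin m → ℕ) (ξ : J → L) (d : J → ℕ) :
    AlgebraicIndependent K (transforms σL fun j : freeIndices hext w ξ d => ξ j) := by
  refine (algebraicIndepOn_range_iff (x := transforms σL ξ)
    (Function.injective_id.prodMap Subtype.val_injective)).1
    ((algebraicIndepOn_notMem_dependentExponents hext ξ d w).mono ?_)
  rintro _ ⟨⟨k, j⟩, rfl⟩
  exact Set.eq_empty_iff_forall_notMem.1 j.2 k

theorem freeIndices_eq_univ [Finite J] (hext : IsDifferenceExtension σK σL) {ξ : J → L}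
    (hξ : AlgebraicIndependent K (transforms σL ξ)) (d : J → ℕ) :
    freeIndices hext w ξ d = Set.univ :=
  Set.eq_univ_of_forall fun _ => Set.eq_empty_of_forall_notMem fun _ =>
    notMem_dependentExponents hext (hξ.comp _ Subtype.val_injective) le_rfl

variable (hext : IsDifferenceExtension σK σL) {ξ : J → L} {ξ' : J' → L} {d : J → ℕ} {d' : J' → ℕ}

section

variable [Fintype J] [Fintype J']

theorem exists_trdeg_eq_dimensionFunction (hw : ∀ i, 0 < w i) (ξ : J → L) (d : J → ℕ) (r : ℕ) :
    ∃ N : ℕ, Algebra.trdeg K (offsetTruncation K σL w ξ d r) = (N : Cardinal) ∧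
      dimensionFunction hext w ξ d r = N := by
  have htrdeg := trdeg_adjoin_image (K := K) (transformKey_injective (w := w) (d := d))
    (transforms σL ξ) (finite_weightedOrder_add_le hw d r)
    fun _ hi _ hj => (weightedOrder_add_le_of_transformKey_lt hj).trans hi
  refine ⟨_, htrdeg, ?_⟩
  rw [dimensionFunction, Finset.sum_apply]
  exact (ncard_eq_sum_complCount hw
    (fun j => (dependentExponents hext w ξ d j : Set (Fin m → ℕ))) d r).symm

theorem exists_quasiPolynomial_dimensionFunction (hw : ∀ i, 0 < w i) (ξ : J → L) (d : J → ℕ) :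
    ∃ Φ : QuasiPolynomial, evalAt Φ =ᶠ[atTop] dimensionFunction hext w ξ d ∧
      Φ.degree ≤ m ∧ IsAlternatingEhrhartSum w Φ ∧ HasPosLeadingTerm (evalAt Φ) ∧
      Φ.coeff m = algebraMap ℚ periodicNumber
        ((freeIndices hext w ξ d).ncard / ((m ! : ℚ) * ∏ i, (w i : ℚ))) :=
  exists_quasiPolynomial_sum_complCount hw _ d

theorem shift_pow_eventuallyLE {f g : ℤ → ℚ} {c : ℕ} (h : ∀ r : ℕ, f r ≤ g ↑(r + c)) :
    (shift ^ c) f ≤ᶠ[atTop] g := by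
  filter_upwards [eventually_ge_atTop (c : ℤ)] with t ht
  obtain ⟨r, hr⟩ := Int.eq_ofNat_of_zero_le (sub_nonneg.2 ht)
  obtain rfl : t = ↑(r + c) := by omega
  rw [shift_pow_apply, hr]
  exact h r

theorem shift_pow_dimensionFunction_eventuallyLE (hw : ∀ i, 0 < w i) {c : ℕ}
    (h : ∀ r, offsetTruncation K σL w ξ d r ≤ offsetTruncation K σL w ξ' d' (r + c)) :
    (shift ^ c) (dimensionFunction hext w ξ d) ≤ᶠ[atTop] dimensionFunction hext w ξ' d' := by
  refine shift_pow_eventuallyLE fun r => ?_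
  obtain ⟨N, htrdeg, hN⟩ := exists_trdeg_eq_dimensionFunction hext hw ξ d r
  obtain ⟨N', htrdeg', hN'⟩ := exists_trdeg_eq_dimensionFunction hext hw ξ' d' (r + c)
  have hle := trdeg_le_of_injective (IntermediateField.inclusion (h r))
    (IntermediateField.inclusion_injective (h r))
  rw [htrdeg, htrdeg'] at hle
  rw [hN, hN']
  exact_mod_cast hle

end

theorem ncard_freeIndices_le [Finite J] [Finite J'] (hw : ∀ i, 0 < w i) {c : ℕ}
    (h : ∀ r, offsetTruncation K σL w ξ d r ≤ offsetTruncation K σL w ξ' d' (r + c)) :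
    (freeIndices hext w ξ d).ncard ≤ (freeIndices hext w ξ' d').ncard := by
  have := Fintype.ofFinite J
  have := Fintype.ofFinite J'
  obtain ⟨Φ, hΦ, hdeg, -, -, hcoeff⟩ := exists_quasiPolynomial_dimensionFunction hext hw ξ d
  obtain ⟨Φ', hΦ', hdeg', -, -, hcoeff'⟩ := exists_quasiPolynomial_dimensionFunction hext hw ξ' d'
  have hlead : HasLeadingTerm m _ (evalAt Φ) := ⟨Φ, natDegree_le_of_degree_le hdeg, hcoeff, rfl⟩
  have hlead' : HasLeadingTerm m _ (evalAt Φ') :=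
    ⟨Φ', natDegree_le_of_degree_le hdeg', hcoeff', rfl⟩
  have hle : (shift ^ c) (evalAt Φ) ≤ᶠ[atTop] evalAt Φ' :=
    ((shift_pow_congr hΦ c).trans_le (shift_pow_dimensionFunction_eventuallyLE hext hw h)).trans_eq
      hΦ'.symm
  have hpos : 0 < (m ! : ℚ) * ∏ i, (w i : ℚ) :=
    mul_pos (mod_cast m.factorial_pos) (Finset.prod_pos fun i _ => mod_cast hw i)
  exact_mod_cast (div_le_div_iff_of_pos_right hpos).1 ((hlead.shift_pow c).le_of_eventuallyLE
    hlead' hle)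

end DimensionFunction

/-! ### Comparison of systems of generators -/

section Truncation

variable {K L : Type*} [Field K] [Field L] [Algebra K L] {m : ℕ}
  {σK : Translations m K} {σL : Translations m L} {J : Type*} {w : Fin m → ℕ}
  {n : ℕ} {η : Fin n → L}

theorem truncation_eq_offsetTruncation (σ : Translations m L) (w : Fin m → ℕ) (η : Fin n → L)
    (r : ℕ) : truncation K σ w η r = offsetTruncation K σ w η 0 r := by
  refine congrArg (IntermediateField.adjoin K) (Set.ext fun x => ?_)
  constructor
  · rintro ⟨k, hk, i, rfl⟩
    exact ⟨(k, i), hk, rfl⟩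
  · rintro ⟨⟨k, i⟩, hk, rfl⟩
    exact ⟨k, hk, i, rfl⟩

theorem offsetTruncation_mono (σ : Translations m L) (w : Fin m → ℕ) (ξ : J → L) (d : J → ℕ) :
    Monotone (offsetTruncation K σ w ξ d) := fun _ _ hrs =>
  IntermediateField.adjoin.mono _ _ _ (Set.image_mono fun _ hp => le_trans hp hrs)

theorem transform_mem_offsetTruncation (hext : IsDifferenceExtension σK σL) {ξ : J → L}
    {d : J → ℕ} {r : ℕ} {x : L} (hx : x ∈ offsetTruncation K σL w ξ d r) (k : Fin m → ℕ) :
    σL.transform k x ∈ offsetTruncation K σL w ξ d (weightedOrder w k + r) := by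
  refine mapsTo_adjoin (hext.semiconj_transform k) ?_ hx
  rintro _ ⟨p, hp, rfl⟩
  refine ⟨(k + p.1, p.2), ?_, σL.transform_add k p.1 (ξ p.2)⟩
  calc weightedOrder w (k + p.1) + d p.2
    _ = weightedOrder w k + (weightedOrder w p.1 + d p.2) := by rw [weightedOrder_add, add_assoc]
    _ ≤ weightedOrder w k + r := Nat.add_le_add_left hp _

theorem Generates.exists_mem_offsetTruncation (hη : Generates K σL η) (w : Fin m → ℕ) (x : L) :
    ∃ r, x ∈ offsetTruncation K σL w η 0 r := by
  have hdir : Directed (· ≤ ·) (offsetTruncation K σL w η 0) :=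
    (offsetTruncation_mono σL w η 0).directed_le
  have htop : ⨆ r, offsetTruncation K σL w η 0 r = ⊤ := by
    refine top_le_iff.1 (hη ▸ IntermediateField.adjoin_le_iff.2 ?_)
    rintro _ ⟨k, _, ⟨i, rfl⟩, rfl⟩
    exact le_iSup (offsetTruncation K σL w η 0) (weightedOrder w k)
      (IntermediateField.subset_adjoin K _ ⟨(k, i), le_refl (weightedOrder w k), rfl⟩)
  have hx : x ∈ ((⨆ r, offsetTruncation K σL w η 0 r : IntermediateField K L) : Set L) :=
    htop ▸ IntermediateField.mem_top
  rwa [IntermediateField.coe_iSup_of_directed hdir, Set.mem_iUnion] at hx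

theorem Generates.exists_offsetTruncation_le [Finite J] (hext : IsDifferenceExtension σK σL)
    (hη : Generates K σL η) (w : Fin m → ℕ) (ξ : J → L) :
    ∃ c, ∀ r, offsetTruncation K σL w ξ 0 r ≤ offsetTruncation K σL w η 0 (r + c) := by
  choose h hh using fun j => hη.exists_mem_offsetTruncation w (ξ j)
  obtain ⟨c, hc⟩ := Finite.bddAbove_range h
  refine ⟨c, fun r => IntermediateField.adjoin_le_iff.2 ?_⟩
  rintro _ ⟨p, hp, rfl⟩
  exact offsetTruncation_mono _ _ _ _ (add_le_add hp (hc ⟨p.2, rfl⟩))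
    (transform_mem_offsetTruncation hext (hh p.2) p.1)

theorem isDimensionQuasiPolynomial_iff (hext : IsDifferenceExtension σK σL) (hw : ∀ i, 0 < w i)
    {Φ : QuasiPolynomial} :
    IsDimensionQuasiPolynomial K σL w η Φ ↔ evalAt Φ =ᶠ[atTop] dimensionFunction hext w η 0 := by
  rw [← Nat.map_cast_int_atTop, EventuallyEq, eventually_map]
  refine eventually_congr (.of_forall fun r => ?_)
  obtain ⟨N, htrdeg, hN⟩ := exists_trdeg_eq_dimensionFunction hext hw η 0 r
  rw [hN, truncation_eq_offsetTruncation, htrdeg]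
  refine ⟨fun ⟨D, hD, hΦ⟩ => hΦ.trans (mod_cast hD.symm), fun hΦ => ⟨N, rfl, hΦ⟩⟩

theorem IsDimensionQuasiPolynomial.hasPosLeadingTerm (hext : IsDifferenceExtension σK σL)
    (hw : ∀ i, 0 < w i) {Φ : QuasiPolynomial} (hΦ : IsDimensionQuasiPolynomial K σL w η Φ) :
    HasPosLeadingTerm (evalAt Φ) := by
  obtain ⟨Ψ, hΨ, -, -, hpos, -⟩ := exists_quasiPolynomial_dimensionFunction hext hw η 0
  obtain rfl : Φ = Ψ :=
    eq_of_evalAt_eventuallyEq (((isDimensionQuasiPolynomial_iff hext hw).1 hΦ).trans hΨ.symm)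
  exact hpos

theorem IsDimensionQuasiPolynomial.exists_shift_pow_eventuallyLE
    (hext : IsDifferenceExtension σK σL) (hw : ∀ i, 0 < w i) (hη : Generates K σL η)
    {k : ℕ} {ζ : Fin k → L} {Φ Ψ : QuasiPolynomial} (hΦ : IsDimensionQuasiPolynomial K σL w η Φ)
    (hΨ : IsDimensionQuasiPolynomial K σL w ζ Ψ) :
    ∃ c, (shift ^ c) (evalAt Ψ) ≤ᶠ[atTop] evalAt Φ := by
  rw [isDimensionQuasiPolynomial_iff hext hw] at hΦ hΨ
  obtain ⟨c, hc⟩ := hη.exists_offsetTruncation_le hext w ζ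
  exact ⟨c, ((shift_pow_congr hΨ c).trans_le
    (shift_pow_dimensionFunction_eventuallyLE hext hw hc)).trans_eq hΦ.symm⟩

theorem IsDimensionQuasiPolynomial.degree_eq_and_leadingCoeff_eq
    (hext : IsDifferenceExtension σK σL) (hw : ∀ i, 0 < w i) (hη : Generates K σL η)
    {k : ℕ} {ζ : Fin k → L} (hζ : Generates K σL ζ) {Φ Ψ : QuasiPolynomial}
    (hΦ : IsDimensionQuasiPolynomial K σL w η Φ) (hΨ : IsDimensionQuasiPolynomial K σL w ζ Ψ) :
    Φ.degree = Ψ.degree ∧ Φ.leadingCoeff = Ψ.leadingCoeff := by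
  obtain ⟨c, hc⟩ := hΨ.exists_shift_pow_eventuallyLE hext hw hζ hΦ
  obtain ⟨c', hc'⟩ := hΦ.exists_shift_pow_eventuallyLE hext hw hη hΨ
  exact (hΦ.hasPosLeadingTerm hext hw).degree_eq_and_leadingCoeff_eq
    (hΨ.hasPosLeadingTerm hext hw) hc hc'

end Truncation

/-! ### The difference transcendence degree -/

section Transcendence

variable {K L : Type*} [Field K] [Field L] [Algebra K L] {m : ℕ}
  {σK : Translations m K} {σL : Translations m L} {I J : Type*} {w : Fin m → ℕ}
  {n : ℕ} {η : Fin n → L}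

theorem algebraicIndependent_transforms_comp {ξ : J → L}
    (h : AlgebraicIndependent K (transforms σL ξ)) {f : I → J} (hf : f.Injective) :
    AlgebraicIndependent K (transforms σL (ξ ∘ f)) :=
  h.comp (Prod.map id f) (Function.injective_id.prodMap hf)

theorem algebraicIndependent_transforms_sumElim_iff {ξ : I → L} {ζ : J → L} :
    AlgebraicIndependent K (transforms σL (Sum.elim ξ ζ)) ↔
      AlgebraicIndependent K (transforms σL ζ) ∧
        AlgebraicIndependent (diffAdjoin K σL (Set.range ζ)) (transforms σL ξ) := by
  have hrange : diffAdjoin K σL (Set.range ζ) =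
      IntermediateField.adjoin K (Set.range (transforms σL ζ)) := by
    refine congrArg (IntermediateField.adjoin K) (Set.ext fun x => ?_)
    constructor
    · rintro ⟨k, _, ⟨j, rfl⟩, rfl⟩
      exact ⟨(k, j), rfl⟩
    · rintro ⟨p, rfl⟩
      exact ⟨p.1, ζ p.2, ⟨p.2, rfl⟩, rfl⟩
  rw [hrange, IntermediateField.algebraicIndependent_adjoin_iff,
    ← AlgebraicIndependent.sumElim_iff]
  refine (algebraicIndependent_equiv' (Equiv.prodSumDistrib _ _ _).symm (funext ?_)).symm
  rintro (p | p) <;> rfl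

theorem algebraicIndependent_transforms_unit_iff {F : IntermediateField K L} {a : L} :
    AlgebraicIndependent F (transforms σL fun _ : Unit => a) ↔
      AlgebraicIndependent F fun k : Fin m → ℕ => σL.transform k a :=
  algebraicIndependent_equiv' (Equiv.prodPUnit _) rfl

theorem isDiffTranscendenceBasis_range {ζ : J → L}
    (hζ : AlgebraicIndependent K (transforms σL ζ))
    (hmax : ∀ a, ¬ AlgebraicIndependent K (transforms σL (Sum.elim (fun _ : Unit => a) ζ))) :
    IsDiffTranscendenceBasis K σL (Set.range ζ) where
  indep := by
    have hinj : ζ.Injective := fun i j hij => by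
      have htransform : transforms σL ζ (0, i) = transforms σL ζ (0, j) :=
        congrArg (σL.transform 0) hij
      exact (Prod.ext_iff.1 (hζ.injective htransform)).2
    have hequiv : AlgebraicIndependent K (transforms σL ζ) ↔
        AlgebraicIndependent K (transforms σL ((↑) : Set.range ζ → L)) :=
      algebraicIndependent_equiv' ((Equiv.refl _).prodCongr (Equiv.ofInjective ζ hinj)) rfl
    exact hequiv.1 hζ
  algebraic a ha := hmax a (algebraicIndependent_transforms_sumElim_iff.2
    ⟨hζ, algebraicIndependent_transforms_unit_iff.2 ha⟩)

theorem natCard_le_ncard_freeIndices [Finite J] (hext : IsDifferenceExtension σK σL)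
    (hw : ∀ i, 0 < w i) (hη : Generates K σL η) {ξ : J → L}
    (hξ : AlgebraicIndependent K (transforms σL ξ)) :
    Nat.card J ≤ (freeIndices hext w η 0).ncard := by
  obtain ⟨c, hc⟩ := hη.exists_offsetTruncation_le hext w ξ
  have hle := ncard_freeIndices_le hext hw hc
  rwa [freeIndices_eq_univ hext hξ, Set.ncard_univ] at hle

theorem isDiffTranscendenceBasis_range_freeIndices (hext : IsDifferenceExtension σK σL)
    (hw : ∀ i, 0 < w i) (hη : Generates K σL η) :
    IsDiffTranscendenceBasis K σL (Set.range fun j : freeIndices hext w η 0 => η j) := by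
  refine isDiffTranscendenceBasis_range
    (algebraicIndependent_transforms_freeIndices hext w η 0) fun a ha => ?_
  have hcard := natCard_le_ncard_freeIndices hext hw hη ha
  rw [Nat.card_sum, Nat.card_unique, Nat.card_coe_set_eq] at hcard
  omega

namespace IsDiffTranscendenceBasis

variable {B : Set L}

theorem finite_and_ncard_le (hB : IsDiffTranscendenceBasis K σL B)
    (hext : IsDifferenceExtension σK σL) (hw : ∀ i, 0 < w i) (hη : Generates K σL η) :
    B.Finite ∧ B.ncard ≤ (freeIndices hext w η 0).ncard := by
  have hsub (s : Set L) (hs : s.Finite) (hsB : s ⊆ B) :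
      s.ncard ≤ (freeIndices hext w η 0).ncard := by
    have := hs.to_subtype
    exact natCard_le_ncard_freeIndices hext hw hη
      (algebraicIndependent_transforms_comp hB.indep (Set.inclusion_injective hsB))
  have hfin : B.Finite := by
    by_contra hinf
    obtain ⟨s, hsB, hs⟩ := Set.Infinite.exists_subset_card_eq hinf
      ((freeIndices hext w η 0).ncard + 1)
    have hcard := hsub s s.finite_toSet hsB
    rw [Set.ncard_coe_finset] at hcard
    omega
  exact ⟨hfin, hsub B hfin le_rfl⟩

theorem exists_not_algebraicIndepOn (hB : IsDiffTranscendenceBasis K σL B) (w : Fin m → ℕ)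
    (ξ : J → L) (j : J) :
    ∃ H, ∀ H' ≥ H, ¬ AlgebraicIndepOn K (transforms σL (Sum.elim ξ ((↑) : B → L)))
      {p | p.2 = .inl j ∨ p.2.isRight ∧ weightedOrder w p.1 ≤ H'} := by
  have hdep : ¬ AlgebraicIndependent K
      (transforms σL (Sum.elim (fun _ : Unit => ξ j) ((↑) : B → L))) := fun h => by
    rw [algebraicIndependent_transforms_sumElim_iff, Subtype.range_coe] at h
    exact hB.algebraic (ξ j) (algebraicIndependent_transforms_unit_iff.1 h.2)
  obtain ⟨t, ht, hdep⟩ := not_forall₂.1 (mt algebraicIndependent_of_finite_type hdep)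
  obtain ⟨H, hH⟩ := (ht.image fun p => weightedOrder w p.1).bddAbove
  refine ⟨H, fun H' hH' hind => hdep ?_⟩
  let f : Unit ⊕ B → J ⊕ B := Sum.map (fun _ => j) id
  have hf : f.Injective := Sum.map_injective.2 ⟨Function.injective_of_subsingleton _,
    Function.injective_id⟩
  have hmem (p : t) : Prod.map id f p.1 ∈
      {p : (Fin m → ℕ) × (J ⊕ B) | p.2 = .inl j ∨ p.2.isRight ∧ weightedOrder w p.1 ≤ H'} := by
    obtain ⟨⟨k, _ | b⟩, hp⟩ := p
    · exact .inl rfl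
    · exact .inr ⟨rfl, (hH ⟨_, hp, rfl⟩).trans hH'⟩
  have hcomp := hind.comp (fun p : t => ⟨Prod.map id f p.1, hmem p⟩) fun p q hpq =>
    Subtype.ext (Function.injective_id.prodMap hf (congrArg Subtype.val hpq))
  convert hcomp using 1
  ext ⟨⟨k, _ | b⟩, hp⟩ <;> rfl

theorem exists_inl_notMem_freeIndices (hB : IsDiffTranscendenceBasis K σL B) [Finite B] [Finite J]
    (hext : IsDifferenceExtension σK σL) (w : Fin m → ℕ) (ξ : J → L) :
    ∃ c : ℕ, ∀ j, .inl j ∉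
      freeIndices hext w (Sum.elim ξ ((↑) : B → L)) (Sum.elim (fun _ => c) 0) := by
  choose H hH using hB.exists_not_algebraicIndepOn w ξ
  obtain ⟨H', hH'⟩ := Finite.bddAbove_range H
  refine ⟨H' + 1, fun j hj => hH j H' (hH' ⟨j, rfl⟩)
    ((algebraicIndepOn_notMem_dependentExponents hext _ (Sum.elim (fun _ => H' + 1) 0) w).mono ?_)⟩
  have hind : AlgebraicIndepOn K (transforms σL (Sum.elim ξ ((↑) : B → L)))
      {p | weightedOrder w p.1 + Sum.elim (fun _ => H' + 1) 0 p.2 ≤ H'} := by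
    have hcomp : AlgebraicIndependent K
        (transforms σL (Sum.elim ξ ((↑) : B → L)) ∘ Prod.map id Sum.inr) := hB.indep
    refine ((algebraicIndepOn_range_iff
      (Function.injective_id.prodMap Sum.inr_injective)).2 hcomp).mono ?_
    rintro ⟨k, j | b⟩ hp
    · have hp' : weightedOrder w k + (H' + 1) ≤ H' := hp
      omega
    · exact ⟨(k, b), rfl⟩
  rintro ⟨k, j' | b⟩ hp
  · obtain rfl : j' = j := by simpa using hp
    exact Set.eq_empty_iff_forall_notMem.1 hj k
  · have hk : weightedOrder w k ≤ H' := by simpa using hp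
    exact notMem_dependentExponents hext hind hk

theorem ncard_freeIndices_le [Finite J] (hB : IsDiffTranscendenceBasis K σL B) (hfin : B.Finite)
    (hext : IsDifferenceExtension σK σL) (hw : ∀ i, 0 < w i) (ξ : J → L) :
    (freeIndices hext w ξ 0).ncard ≤ B.ncard := by
  have := hfin.to_subtype
  obtain ⟨c, hc⟩ := hB.exists_inl_notMem_freeIndices hext w ξ
  have htrunc (r : ℕ) : offsetTruncation K σL w ξ 0 r ≤
      offsetTruncation K σL w (Sum.elim ξ ((↑) : B → L)) (Sum.elim (fun _ => c) 0) (r + c) := by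
    refine IntermediateField.adjoin.mono _ _ _ ?_
    rintro _ ⟨⟨k, j⟩, hk, rfl⟩
    exact ⟨(k, .inl j), Nat.add_le_add_right hk c, rfl⟩
  have hsub : freeIndices hext w (Sum.elim ξ ((↑) : B → L)) (Sum.elim (fun _ => c) 0) ⊆
      Set.range Sum.inr := by
    rintro (j | b) hj
    · exact absurd hj (hc j)
    · exact ⟨b, rfl⟩
  calc (freeIndices hext w ξ 0).ncard
    _ ≤ (freeIndices hext w (Sum.elim ξ ((↑) : B → L)) (Sum.elim (fun _ => c) 0)).ncard :=
      WeightedDifference.ncard_freeIndices_le hext hw htrunc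
    _ ≤ (Set.range (Sum.inr : B → J ⊕ B)).ncard := Set.ncard_le_ncard hsub
    _ = B.ncard := by rw [← Set.image_univ, Set.ncard_image_of_injective _ Sum.inr_injective,
      Set.ncard_univ, Nat.card_coe_set_eq]

end IsDiffTranscendenceBasis

theorem hasDiffTrdeg_ncard_freeIndices (hext : IsDifferenceExtension σK σL) (hw : ∀ i, 0 < w i)
    (hη : Generates K σL η) : HasDiffTrdeg K σL (freeIndices hext w η 0).ncard := by
  refine ⟨⟨_, isDiffTranscendenceBasis_range_freeIndices hext hw hη⟩, fun B hB => ?_⟩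
  obtain ⟨hfin, hle⟩ := hB.finite_and_ncard_le hext hw hη
  exact ⟨hfin, hle.antisymm (hB.ncard_freeIndices_le hfin hext hw η)⟩

end Transcendence

end WeightedDifference

open WeightedDifference in
theorem theorem4_general {K L : Type*} [Field K] [Field L] [Algebra K L] {m : ℕ}
    (σK : Translations m K) (σL : Translations m L) (hext : IsDifferenceExtension σK σL)
    (w : Fin m → ℕ) (hw : ∀ i, 0 < w i)
    {n : ℕ} (η : Fin n → L) (hη : Generates K σL η) :
    ∃ Φ : QuasiPolynomial,
      IsDimensionQuasiPolynomial K σL w η Φ ∧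
      Φ.degree ≤ (m : WithBot ℕ) ∧
      IsAlternatingEhrhartSum w Φ ∧
      (∃ c : ℚ, Φ.leadingCoeff = algebraMap ℚ periodicNumber c) ∧
      (∀ (k : ℕ) (ζ : Fin k → L), Generates K σL ζ →
        ∀ Ψ : QuasiPolynomial, IsDimensionQuasiPolynomial K σL w ζ Ψ →
          Ψ.degree = Φ.degree ∧ Ψ.leadingCoeff = Φ.leadingCoeff) ∧
      ∃ a : ℕ, HasDiffTrdeg K σL a ∧
        Φ.coeff m = algebraMap ℚ periodicNumber ((a : ℚ) / ((m ! : ℚ) * ∏ i, (w i : ℚ))) := by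
  obtain ⟨Φ, hΦ, hdeg, halt, hpos, hcoeff⟩ := exists_quasiPolynomial_dimensionFunction hext hw η 0
  have hdim : IsDimensionQuasiPolynomial K σL w η Φ :=
    (isDimensionQuasiPolynomial_iff hext hw).2 hΦ
  exact ⟨Φ, hdim, hdeg, halt, hpos.exists_leadingCoeff_eq_algebraMap,
    fun _ _ hζ _ hΨ => hΨ.degree_eq_and_leadingCoeff_eq hext hw hζ hη hdim,
    _, hasDiffTrdeg_ncard_freeIndices hext hw hη, hcoeff⟩

open WeightedDifference in
theorem theorem4 {K L : Type*} [Field K] [CharZero K] [Field L] [Algebra K L] {m : ℕ}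
    (σK : Translations m K) (σL : Translations m L) (hext : IsDifferenceExtension σK σL)
    (w : Fin m → ℕ) (hw : ∀ i, 0 < w i)
    {n : ℕ} (η : Fin n → L) (hη : Generates K σL η) :
    ∃ Φ : QuasiPolynomial,
      IsDimensionQuasiPolynomial K σL w η Φ ∧
      Φ.degree ≤ (m : WithBot ℕ) ∧
      IsAlternatingEhrhartSum w Φ ∧
      (∃ c : ℚ, Φ.leadingCoeff = algebraMap ℚ periodicNumber c) ∧
      (∀ (k : ℕ) (ζ : Fin k → L), Generates K σL ζ →
        ∀ Ψ : QuasiPolynomial, IsDimensionQuasiPolynomial K σL w ζ Ψ →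
          Ψ.degree = Φ.degree ∧ Ψ.leadingCoeff = Φ.leadingCoeff) ∧
      ∃ a : ℕ, HasDiffTrdeg K σL a ∧
        Φ.coeff m = algebraMap ℚ periodicNumber ((a : ℚ) / ((m ! : ℚ) * ∏ i, (w i : ℚ))) :=
  theorem4_general σK σL hext w hw η hη
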